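/- Let $G$ be a locally compact (Hausdorff) group and let $\omega\colon G\to[1,\infty)$ be a continuous weight, i.e. a continuous function with $\omega(xy)\le\omega(x)\omega(y)$ for all $x,y\in G$. Let $M_b(G,\omega)$ be the Banach algebra of all complex regular Borel measures $\mu$ on $G$ with $\|\mu\|_\omega:=\int_G\omega\,d|\mu|<\infty$, with the norm $\|\cdot\|_\omega$ and the convolution product $(\mu*\nu)(E)=\int_G\nu(x^{-1}E)\,d\mu(x)$ for Borel sets $E\subseteq G$. Then $M_b(G,\omega)$ is a $\mathcal{WAP}$-algebra. Here, for a complex Banach algebra $A$ and $f\in A^*$, $a\in A$, the functional $f\cdot a\in A^*$ is given by $\langle f\cdot a,b\rangle=\langle f,ab\rangle$; the functional $f$ is weakly almost periodic if $\{f\cdot a:\|a\|\le 1\}$ is relatively weakly compact in $A^*$; $\mathcal{WAP}(A)\subseteq A^*$ is the subspace of all weakly almost periodic functionals; and $A$ is a $\mathcal{WAP}$-algebra if the natural map $\phi\colon A\to\mathcal{WAP}(A)^*$, $\langle\phi(a),f\rangle=\langle f,a\rangle$, is bounded below, i.e. $\inf\{\|\phi(a)\|:\|a\|\ge1\}>0$.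 -/

import Mathlib

set_option linter.unusedSectionVars false

noncomputable section

namespace WeightedConvolution

open MeasureTheory Filter Topology Set
open scoped ENNReal

section Positive

variable {G : Type*} [Group G] [TopologicalSpace G] [IsTopologicalGroup G]
  [LocallyCompactSpace G] [T2Space G] [MeasurableSpace G] [BorelSpace G]

theorem innerRegular_of_le {m n : Measure G} [IsFiniteMeasure n] [n.InnerRegular]
    (h : m ≤ n) : m.InnerRegular := by
  have : IsFiniteMeasure m := isFiniteMeasure_of_le n h
  refine ⟨fun s hs r hr => ?_⟩
  have hε : m s - r ≠ 0 := (tsub_pos_of_lt hr).ne'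
  obtain ⟨K, hKs, hK, hlt⟩ := hs.exists_isCompact_sdiff_lt (measure_ne_top n s) hε
  refine ⟨K, hKs, hK, ?_⟩
  by_contra hcon
  have h1 : m s ≤ m K + m (s \ K) := by
    rw [← measure_union disjoint_sdiff_right (hs.diff hK.measurableSet)]
    exact measure_mono (by simp)
  have h2 : m (s \ K) < m s - r := (h _).trans_lt hlt
  have h3 : m (s \ K) + r < m s := by
    rwa [lt_tsub_iff_right] at h2
  have : m s < m s := by
    calc m s ≤ m K + m (s \ K) := h1
      _ ≤ r + m (s \ K) := by gcongr; exact not_lt.1 hcon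
      _ = m (s \ K) + r := add_comm _ _
      _ < m s := h3
  exact lt_irrefl _ this

theorem lowerSemicontinuous_translate (p : Measure G) [p.Regular] {U : Set G} (hU : IsOpen U) :
    LowerSemicontinuous fun x => p ((x * ·) ⁻¹' U) := by
  intro x c hc
  have hopen : IsOpen ((x * ·) ⁻¹' U) := hU.preimage (continuous_const_mul x)
  obtain ⟨C, hCU, hC, hcC⟩ := hopen.exists_lt_isCompact hc
  have : ∀ᶠ y in 𝓝 x, ∀ z ∈ C, y * z ∈ U := by
    refine hC.eventually_forall_of_forall_eventually fun z hz => ?_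
    have : Continuous fun q : G × G => q.1 * q.2 := continuous_mul
    exact (this.continuousAt (x := (x, z))).eventually (hU.mem_nhds (hCU hz))
  filter_upwards [this] with y hy
  exact hcC.trans_le (measure_mono hy)

theorem measurable_translate (p : Measure G) [IsFiniteMeasure p] [p.Regular] {E : Set G}
    (hE : MeasurableSet E) : Measurable fun x => p ((x * ·) ⁻¹' E) := by
  induction E, hE using MeasurableSet.induction_on_open with
  | isOpen U hU => exact (lowerSemicontinuous_translate p hU).measurable
  | compl t ht ih =>
    have : (fun x => p ((x * ·) ⁻¹' tᶜ)) = fun x => p univ - p ((x * ·) ⁻¹' t) := by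
      ext x
      rw [preimage_compl, measure_compl (measurable_const_mul x ht) (measure_ne_top _ _)]
    rw [this]
    exact measurable_const.sub ih
  | iUnion f hd hf ih =>
    have : (fun x => p ((x * ·) ⁻¹' ⋃ i, f i)) = fun x => ∑' i, p ((x * ·) ⁻¹' f i) := by
      ext x
      rw [preimage_iUnion, measure_iUnion (fun i j hij => (hd hij).preimage _)
        (fun i => measurable_const_mul x (hf i))]
    rw [this]
    exact Measurable.tsum ih

theorem measurable_map_mul (p : Measure G) [IsFiniteMeasure p] [p.Regular] :
    Measurable fun x => p.map (x * ·) := by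
  refine Measure.measurable_of_measurable_coe _ fun E hE => ?_
  have : (fun x => p.map (x * ·) E) = fun x => p ((x * ·) ⁻¹' E) := by
    ext x
    rw [Measure.map_apply (measurable_const_mul x) hE]
  rw [this]
  exact measurable_translate p hE

/-- The convolution of two positive measures, `E ↦ ∫ p (x⁻¹ E) dm(x)`. -/
def posConv (m p : Measure G) : Measure G := m.bind fun x => p.map (x * ·)

theorem posConv_apply (m p : Measure G) [IsFiniteMeasure p] [p.Regular] {E : Set G}
    (hE : MeasurableSet E) : posConv m p E = ∫⁻ x, p ((x * ·) ⁻¹' E) ∂m := by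
  rw [posConv, Measure.bind_apply hE (measurable_map_mul p).aemeasurable]
  refine lintegral_congr fun x => ?_
  rw [Measure.map_apply (measurable_const_mul x) hE]

theorem lintegral_posConv (m p : Measure G) [IsFiniteMeasure p] [p.Regular] {f : G → ℝ≥0∞}
    (hf : Measurable f) : ∫⁻ z, f z ∂(posConv m p) = ∫⁻ x, ∫⁻ y, f (x * y) ∂p ∂m := by
  rw [posConv, Measure.lintegral_bind (measurable_map_mul p).aemeasurable hf.aemeasurable]
  refine lintegral_congr fun x => ?_
  rw [lintegral_map hf (measurable_const_mul x)]

theorem isFiniteMeasure_posConv (m p : Measure G) [IsFiniteMeasure m] [IsFiniteMeasure p]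
    [p.Regular] : IsFiniteMeasure (posConv m p) := by
  refine ⟨?_⟩
  rw [posConv_apply m p MeasurableSet.univ]
  simp only [preimage_univ, lintegral_const]
  exact ENNReal.mul_lt_top (measure_lt_top _ _) (measure_lt_top _ _)

theorem regular_posConv (m p : Measure G) [IsFiniteMeasure m] [IsFiniteMeasure p]
    [m.Regular] [p.Regular] : (posConv m p).Regular := by
  have hfin := isFiniteMeasure_posConv m p
  have key : (posConv m p).InnerRegularWRT IsCompact IsOpen := by
    intro U hU r hr
    rw [posConv_apply m p hU.measurableSet] at hr
    obtain ⟨ε, hε, hεr⟩ : ∃ ε : ℝ≥0∞, 0 < ε ∧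
        r + (ε + (ε * m univ + p univ * ε)) < ∫⁻ x, p ((x * ·) ⁻¹' U) ∂m := by
      have hcont : Tendsto (fun ε : ℝ≥0∞ => r + (ε + (ε * m univ + p univ * ε))) (𝓝[>] 0)
          (𝓝 (r + (0 + (0 * m univ + p univ * 0)))) := by
        refine Tendsto.mono_left ?_ nhdsWithin_le_nhds
        refine tendsto_const_nhds.add (tendsto_id.add ((ENNReal.Tendsto.mul_const tendsto_id
          (Or.inr (measure_ne_top _ _))).add (ENNReal.Tendsto.const_mul tendsto_id
          (Or.inr (measure_ne_top _ _)))))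
      have h0 : r + (0 + (0 * m univ + p univ * 0)) < ∫⁻ x, p ((x * ·) ⁻¹' U) ∂m := by
        simpa using hr
      obtain ⟨ε, h1, h2⟩ := ((hcont.eventually_lt_const h0).and self_mem_nhdsWithin).exists
      exact ⟨ε, h2, h1⟩
    obtain ⟨g, hg, hgu, hgint⟩ := exists_upperSemicontinuous_le_lintegral_le (μ := m)
      (fun x => (p ((x * ·) ⁻¹' U)).toNNReal) (ε := ε) (by
        simp only [ENNReal.coe_toNNReal (measure_ne_top _ _)]
        rw [← posConv_apply m p hU.measurableSet]
        exact measure_ne_top _ _) hε.ne'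
    simp only [ENNReal.coe_toNNReal (measure_ne_top _ _)] at hgint
    have hg' : ∀ x, (g x : ℝ≥0∞) ≤ p ((x * ·) ⁻¹' U) := fun x => by
      rw [← ENNReal.coe_toNNReal (measure_ne_top p ((x * ·) ⁻¹' U))]
      exact_mod_cast hg x
    obtain ⟨K, -, hK, hKlt⟩ := (MeasurableSet.univ (α := G)).exists_isCompact_sdiff_lt
      (measure_ne_top m univ) hε.ne'
    have loc : ∀ x ∈ K, ∃ V ∈ 𝓝 x, ∃ D : Set G, IsCompact D ∧ D ⊆ U ∧
        ∀ y ∈ V, (g y : ℝ≥0∞) ≤ p ((y * ·) ⁻¹' D) + ε := by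
      intro x _
      have hopen : IsOpen ((x * ·) ⁻¹' U) := hU.preimage (continuous_const_mul x)
      obtain ⟨C, hCU, hC, hcC⟩ := hopen.measurableSet.exists_isCompact_lt_add
        (measure_ne_top p _) hε.ne'
      have h1 : ∀ᶠ y in 𝓝 x, ∀ z ∈ C, y * z ∈ U := by
        refine hC.eventually_forall_of_forall_eventually fun z hz => ?_
        have : Continuous fun q : G × G => q.1 * q.2 := continuous_mul
        exact (this.continuousAt (x := (x, z))).eventually (hU.mem_nhds (hCU hz))
      have hgx : g x < (p C + ε).toNNReal ∨ p C + ε = ∞ := by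
        by_cases htop : p C + ε = ∞
        · exact Or.inr htop
        · left
          have := (hg' x).trans_lt hcC
          rw [← ENNReal.coe_toNNReal htop] at this
          exact_mod_cast this
      have h2 : ∀ᶠ y in 𝓝 x, (g y : ℝ≥0∞) ≤ p C + ε := by
        rcases hgx with h | h
        · filter_upwards [hgu x _ h] with y hy
          have : (g y : ℝ≥0∞) ≤ ((p C + ε).toNNReal : ℝ≥0∞) := by exact_mod_cast hy.le
          exact this.trans ENNReal.coe_toNNReal_le_self
        · simp [h]
      obtain ⟨V, hV, hVs, hVc⟩ := local_compact_nhds (h1.and h2)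
      refine ⟨V, hV, (fun q : G × G => q.1 * q.2) '' (V ×ˢ C),
        (hVc.prod hC).image continuous_mul, ?_, fun y hy => ?_⟩
      · rintro _ ⟨⟨a, b⟩, ⟨ha, hb⟩, rfl⟩
        exact (hVs ha).1 b hb
      · refine (hVs hy).2.trans ?_
        gcongr
        intro z hz
        exact ⟨(y, z), ⟨hy, hz⟩, rfl⟩
    choose! V hV D hD hDU hVD using loc
    obtain ⟨t, htK, hcov⟩ := hK.elim_nhds_subcover V hV
    set L : Set G := ⋃ x ∈ t, D x with hL
    have hLc : IsCompact L := t.isCompact_biUnion fun x hx => hD x (htK x hx)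
    refine ⟨L, iUnion₂_subset fun x hx => hDU x (htK x hx), hLc, ?_⟩
    by_contra hcon
    rw [not_lt, posConv_apply m p hLc.measurableSet] at hcon
    have hgb : ∀ y, (g y : ℝ≥0∞) ≤
        (p ((y * ·) ⁻¹' L) + ε) + (univ \ K).indicator (fun _ => p univ) y := by
      intro y
      by_cases hy : y ∈ K
      · obtain ⟨x, hx, hyx⟩ := mem_iUnion₂.1 (hcov hy)
        refine ((hVD x (htK x hx) y hyx).trans ?_).trans le_self_add
        gcongr
        exact subset_biUnion_of_mem (u := fun x => D x) hx
      · have : y ∈ univ \ K := ⟨trivial, hy⟩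
        rw [indicator_of_mem this]
        exact ((hg' y).trans (measure_mono (subset_univ _))).trans le_add_self
    have hbound : ∫⁻ y, (g y : ℝ≥0∞) ∂m ≤ r + (ε * m univ + p univ * ε) := by
      calc ∫⁻ y, (g y : ℝ≥0∞) ∂m
          ≤ ∫⁻ y, ((p ((y * ·) ⁻¹' L) + ε) + (univ \ K).indicator (fun _ => p univ) y) ∂m :=
            lintegral_mono hgb
        _ = (∫⁻ y, p ((y * ·) ⁻¹' L) ∂m + ε * m univ) + p univ * m (univ \ K) := by
            have hm := MeasurableSet.univ.diff hK.measurableSet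
            rw [lintegral_add_right _ (measurable_const.indicator hm),
              lintegral_add_right _ measurable_const, lintegral_const,
              lintegral_indicator_const hm]
        _ ≤ (r + ε * m univ) + p univ * ε := by gcongr
        _ = r + (ε * m univ + p univ * ε) := by ring
    refine lt_irrefl (∫⁻ x, p ((x * ·) ⁻¹' U) ∂m) ?_
    calc ∫⁻ x, p ((x * ·) ⁻¹' U) ∂m ≤ ∫⁻ y, (g y : ℝ≥0∞) ∂m + ε := hgint
      _ ≤ r + (ε * m univ + p univ * ε) + ε := by gcongr
      _ = r + (ε + (ε * m univ + p univ * ε)) := by ring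
      _ < _ := hεr
  have hw : (posConv m p).WeaklyRegular :=
    Measure.InnerRegularWRT.weaklyRegular_of_finite _ (fun U hU r hr => by
      obtain ⟨K, h1, h2, h3⟩ := key hU r hr
      exact ⟨K, h1, h2.isClosed, h3⟩)
  exact { innerRegular := key }

end Positive


section Complex

variable {G : Type*} [Group G] [TopologicalSpace G] [IsTopologicalGroup G]
  [LocallyCompactSpace G] [T2Space G] [MeasurableSpace G] [BorelSpace G]

theorem measurable_complex_translate (ν : ComplexMeasure G) [IsFiniteMeasure ν.variation]
    [ν.variation.Regular] {E : Set G} (hE : MeasurableSet E) :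
    Measurable fun x => ν ((x * ·) ⁻¹' E) := by
  have signed : ∀ s : SignedMeasure G, s.variation ≤ ν.variation →
      Measurable fun x => s ((x * ·) ⁻¹' E) := by
    intro s hs
    have part : ∀ p : Measure G, p ≤ s.totalVariation → [IsFiniteMeasure p] →
        Measurable fun x => p.real ((x * ·) ⁻¹' E) := by
      intro p hp _
      rw [SignedMeasure.totalVariation_eq_variation] at hp
      have : p.InnerRegular := innerRegular_of_le (hp.trans hs)
      exact (measurable_translate p hE).ennreal_toReal
    have h1 := part s.toJordanDecomposition.posPart (by
      rw [SignedMeasure.totalVariation]; exact Measure.le_add_right le_rfl)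
    have h2 := part s.toJordanDecomposition.negPart (by
      rw [SignedMeasure.totalVariation]; exact Measure.le_add_left le_rfl)
    have : (fun x => s ((x * ·) ⁻¹' E)) = fun x =>
        s.toJordanDecomposition.posPart.real ((x * ·) ⁻¹' E) -
        s.toJordanDecomposition.negPart.real ((x * ·) ⁻¹' E) := by
      ext x
      have hx : MeasurableSet ((x * ·) ⁻¹' E) := measurable_const_mul x hE
      conv_lhs => rw [← SignedMeasure.toSignedMeasure_toJordanDecomposition s]
      rw [JordanDecomposition.toSignedMeasure, _root_.sub_apply,
        Measure.toSignedMeasure_apply_measurable hx, Measure.toSignedMeasure_apply_measurable hx]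
    rw [this]
    exact h1.sub h2
  have hre := signed (ComplexMeasure.re ν)
    (VectorMeasure.variation_le_of_forall_enorm_le fun F _ => by
      refine le_trans ?_ (VectorMeasure.enorm_measure_le_variation ν F)
      exact enorm_le_iff_norm_le.2 (Complex.abs_re_le_norm _))
  have him := signed (ComplexMeasure.im ν)
    (VectorMeasure.variation_le_of_forall_enorm_le fun F _ => by
      refine le_trans ?_ (VectorMeasure.enorm_measure_le_variation ν F)
      exact enorm_le_iff_norm_le.2 (Complex.abs_im_le_norm _))
  have : (fun x => ν ((x * ·) ⁻¹' E)) = fun x =>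
      ((ComplexMeasure.re ν ((x * ·) ⁻¹' E) : ℝ) : ℂ) +
      ((ComplexMeasure.im ν ((x * ·) ⁻¹' E) : ℝ) : ℂ) * Complex.I := by
    ext x
    exact (Complex.re_add_im _).symm
  rw [this]
  exact (Complex.measurable_ofReal.comp hre).add
    ((Complex.measurable_ofReal.comp him).mul_const _)

/-- The integral `∫ f dμ` of a complex function against a complex measure. -/
def cintegral (μ : ComplexMeasure G) (f : G → ℂ) : ℂ :=
  μ.integral f (ContinuousLinearMap.mul ℝ ℂ)

theorem integrable_of_bound {μ : ComplexMeasure G} [IsFiniteMeasure μ.variation] {f : G → ℂ}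
    (hf : Measurable f) {C : ℝ} (hC : ∀ x, ‖f x‖ ≤ C) : Integrable f μ.variation :=
  Integrable.of_bound hf.aestronglyMeasurable C (Eventually.of_forall hC)

theorem enorm_cintegral_le (μ : ComplexMeasure G) (f : G → ℂ) :
    ‖cintegral μ f‖ₑ ≤ ∫⁻ x, ‖f x‖ₑ ∂μ.variation := by
  refine (VectorMeasure.enorm_integral_le_lintegral_enorm).trans ?_
  refine mul_le_of_le_one_left (by simp) ?_
  simp

theorem norm_cintegral_le {μ : ComplexMeasure G} [IsFiniteMeasure μ.variation] {f : G → ℂ}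
    {C : ℝ} (hC : ∀ x, ‖f x‖ ≤ C) : ‖cintegral μ f‖ ≤ C * μ.variation.real univ := by
  have h0 : 0 ≤ C := (norm_nonneg _).trans (hC 1)
  have := VectorMeasure.norm_integral_le_lintegral_norm (μ := μ) (f := f)
    (B := ContinuousLinearMap.mul ℝ ℂ)
  have h1 : ∫⁻ a, ENNReal.ofReal ‖f a‖ ∂μ.variation ≤ ENNReal.ofReal C * μ.variation univ := by
    rw [← lintegral_const]
    exact lintegral_mono fun x => ENNReal.ofReal_le_ofReal (hC x)
  have h2 := ENNReal.toReal_mono (by finiteness) h1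
  rw [ENNReal.toReal_mul, ENNReal.toReal_ofReal h0] at h2
  refine this.trans (le_trans (mul_le_of_le_one_left (by simp)
    (ContinuousLinearMap.opNorm_mul_le ℝ ℂ)) h2)

theorem cintegral_add {μ : ComplexMeasure G} {f g : G → ℂ} (hf : Integrable f μ.variation)
    (hg : Integrable g μ.variation) :
    cintegral μ (fun x => f x + g x) = cintegral μ f + cintegral μ g :=
  VectorMeasure.integral_fun_add hf hg

theorem cintegral_indicator {μ : ComplexMeasure G} [IsFiniteMeasure μ.variation] {E : Set G}
    (hE : MeasurableSet E) (c : ℂ) : cintegral μ (E.indicator fun _ => c) = c * μ E := by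
  rw [cintegral, VectorMeasure.integral_indicator_const _ hE]
  rfl

theorem cintegral_const_mul {μ : ComplexMeasure G} {f : G → ℂ} (hf : Integrable f μ.variation)
    (c : ℂ) : cintegral μ (fun x => c * f x) = c * cintegral μ f := by
  have h1 := VectorMeasure.continuousLinearMap_apply_integral (B := ContinuousLinearMap.mul ℝ ℂ)
    (C := ContinuousLinearMap.mul ℝ ℂ c) hf
  have h2 := VectorMeasure.integral_continuousLinearMap_comp (B := ContinuousLinearMap.mul ℝ ℂ)
    (C := ContinuousLinearMap.mul ℝ ℂ c) hf
  have h3 : (ContinuousLinearMap.compL ℝ ℂ ℂ ℂ (ContinuousLinearMap.mul ℝ ℂ c)) ∘L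
      (ContinuousLinearMap.mul ℝ ℂ) =
      (ContinuousLinearMap.mul ℝ ℂ) ∘L (ContinuousLinearMap.mul ℝ ℂ c) := by
    ext
    simp [mul_assoc]
  rw [h3, ← h2] at h1
  exact h1.symm

theorem tendsto_cintegral {μ : ComplexMeasure G} [IsFiniteMeasure μ.variation] {F : ℕ → G → ℂ}
    {f : G → ℂ} {C : ℝ} (hF : ∀ n, Measurable (F n)) (hC : ∀ n x, ‖F n x‖ ≤ C)
    (h : ∀ x, Tendsto (fun n => F n x) atTop (𝓝 (f x))) :
    Tendsto (fun n => cintegral μ (F n)) atTop (𝓝 (cintegral μ f)) :=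
  VectorMeasure.tendsto_integral_filter_of_norm_le_const
    (Eventually.of_forall fun n => (hF n).aestronglyMeasurable)
    ⟨C, Eventually.of_forall fun n => Eventually.of_forall (hC n)⟩ (Eventually.of_forall h)

/-- Induction principle for bounded Borel functions. -/
theorem bounded_induction {P : (G → ℂ) → Prop}
    (hind : ∀ (c : ℂ) (E : Set G), MeasurableSet E → P (E.indicator fun _ => c))
    (hadd : ∀ f g : G → ℂ, Measurable f → Measurable g → (∃ C : ℝ, ∀ x, ‖f x‖ ≤ C) →
      (∃ C : ℝ, ∀ x, ‖g x‖ ≤ C) → P f → P g → P fun x => f x + g x)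
    (hlim : ∀ (F : ℕ → G → ℂ) (f : G → ℂ) (C : ℝ), (∀ n, Measurable (F n)) →
      (∀ n x, ‖F n x‖ ≤ C) → (∀ x, Tendsto (fun n => F n x) atTop (𝓝 (f x))) →
      (∀ n, P (F n)) → P f)
    {f : G → ℂ} (hf : Measurable f) {C : ℝ} (hC : ∀ x, ‖f x‖ ≤ C) : P f := by
  have h0 : 0 ≤ C := (norm_nonneg _).trans (hC 1)
  have bdd : ∀ g : SimpleFunc G ℂ, ∃ C : ℝ, ∀ x, ‖g x‖ ≤ C := fun g =>
    (g.map (fun z : ℂ => ‖z‖)).exists_forall_le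
  have simple : ∀ g : SimpleFunc G ℂ, P g := by
    intro g
    induction g using SimpleFunc.induction with
    | const c hs =>
      convert hind c _ hs using 1
      ext x
      simp [indicator, SimpleFunc.coe_piecewise, piecewise]
    | add _ hf hg =>
      exact hadd _ _ (SimpleFunc.measurable _) (SimpleFunc.measurable _) (bdd _) (bdd _) hf hg
  have hs : StronglyMeasurable f := hf.stronglyMeasurable
  exact hlim (fun n => hs.approxBounded C n) f C (fun n => SimpleFunc.measurable _)
    (fun n x => hs.norm_approxBounded_le h0 n x)
    (fun x => hs.tendsto_approxBounded_of_norm_le (hC x)) (fun n => simple _)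

theorem cintegral_smul_measure {μ : ComplexMeasure G} [IsFiniteMeasure μ.variation] {f : G → ℂ}
    (hf : Measurable f) {C : ℝ} (hC : ∀ x, ‖f x‖ ≤ C) (c : ℂ) :
    cintegral (c • μ) f = c * cintegral μ f := by
  refine bounded_induction (P := fun f => cintegral (c • μ) f = c * cintegral μ f)
    ?_ ?_ ?_ hf hC
  · intro d E hE
    rw [cintegral_indicator hE, cintegral_indicator hE, _root_.smul_apply, smul_eq_mul]
    ring
  · rintro f g hf hg ⟨C, hC⟩ ⟨D, hD⟩ h1 h2
    rw [cintegral_add (integrable_of_bound hf hC) (integrable_of_bound hg hD),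
      cintegral_add (integrable_of_bound hf hC) (integrable_of_bound hg hD), h1, h2, mul_add]
  · intro F f C hF hC hlim h
    refine tendsto_nhds_unique (tendsto_cintegral (μ := c • μ) hF hC hlim) ?_
    simp_rw [h]
    exact (tendsto_cintegral hF hC hlim).const_mul c

theorem cintegral_add_measure {μ ν : ComplexMeasure G} {f : G → ℂ}
    (hf : Integrable f μ.variation) (hg : Integrable f ν.variation) :
    cintegral (μ + ν) f = cintegral μ f + cintegral ν f :=
  VectorMeasure.integral_add_vectorMeasure hf hg

theorem norm_translate_le (ν : ComplexMeasure G) [IsFiniteMeasure ν.variation]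
    (E : Set G) : ‖ν E‖ ≤ ν.variation.real univ :=
  (VectorMeasure.norm_measure_le_variation).trans (measureReal_mono (subset_univ _))

open scoped Classical in
/-- The convolution of complex regular Borel measures,
`(μ * ν)(E) = ∫ ν (x⁻¹ E) dμ(x)` for Borel sets `E`; here `x⁻¹ E` is the preimage of `E` under
`y ↦ x y`. (The image of a product measure is not used, since multiplication need not be measurable
for the product of the Borel σ-algebras when `G` is not second countable.) -/
def conv (μ ν : ComplexMeasure G) [IsFiniteMeasure μ.variation] [IsFiniteMeasure ν.variation]
    [ν.variation.Regular] : ComplexMeasure G :=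
  have := isFiniteMeasure_posConv μ.variation ν.variation
  VectorMeasure.of_additive_of_le_measure (μ := posConv μ.variation ν.variation)
    (fun E => if MeasurableSet E then cintegral μ fun x => ν ((x * ·) ⁻¹' E) else 0)
    (by
      intro E
      split_ifs with hE
      · refine (enorm_cintegral_le _ _).trans ?_
        rw [posConv_apply _ _ hE]
        exact lintegral_mono fun x => VectorMeasure.enorm_measure_le_variation _ _
      · simp)
    (by
      intro E F hE hF hEF
      simp only [hE, hF, hE.union hF, if_true]
      rw [← cintegral_add
        (integrable_of_bound (measurable_complex_translate ν hE) fun x => norm_translate_le ν _)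
        (integrable_of_bound (measurable_complex_translate ν hF) fun x => norm_translate_le ν _)]
      congr 1
      ext x
      rw [preimage_union, VectorMeasure.of_union (hEF.preimage _) (measurable_const_mul x hE)
        (measurable_const_mul x hF)])
    (by intro E hE; simp [hE])

section conv

variable (μ ν : ComplexMeasure G) [IsFiniteMeasure μ.variation] [IsFiniteMeasure ν.variation]
    [ν.variation.Regular]

theorem conv_apply {E : Set G} (hE : MeasurableSet E) :
    conv μ ν E = cintegral μ fun x => ν ((x * ·) ⁻¹' E) := if_pos hE

theorem variation_conv_le : (conv μ ν).variation ≤ posConv μ.variation ν.variation := by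
  refine VectorMeasure.variation_le_of_forall_enorm_le fun E hE => ?_
  rw [conv_apply μ ν hE, posConv_apply _ _ hE]
  exact (enorm_cintegral_le _ _).trans
    (lintegral_mono fun x => VectorMeasure.enorm_measure_le_variation _ _)

theorem isFinite_conv : IsFiniteMeasure (conv μ ν).variation :=
  have := isFiniteMeasure_posConv μ.variation ν.variation
  isFiniteMeasure_of_le _ (variation_conv_le μ ν)

theorem regular_conv [μ.variation.Regular] : (conv μ ν).variation.Regular := by
  have := isFiniteMeasure_posConv μ.variation ν.variation
  have := regular_posConv μ.variation ν.variation
  have := isFinite_conv μ ν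
  have := innerRegular_of_le (variation_conv_le μ ν)
  infer_instance

theorem cintegral_conv {f : G → ℂ} (hf : Measurable f) {C : ℝ} (hC : ∀ x, ‖f x‖ ≤ C) :
    (Measurable fun x => cintegral ν fun y => f (x * y)) ∧
    cintegral (conv μ ν) f = cintegral μ fun x => cintegral ν fun y => f (x * y) := by
  have hfin := isFinite_conv μ ν
  have hm : ∀ {f : G → ℂ}, Measurable f → ∀ x, Measurable fun y => f (x * y) :=
    fun hf x => hf.comp (measurable_const_mul x)
  refine bounded_induction (P := fun f => (Measurable fun x => cintegral ν fun y => f (x * y)) ∧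
    cintegral (conv μ ν) f = cintegral μ fun x => cintegral ν fun y => f (x * y)) ?_ ?_ ?_ hf hC
  · intro c E hE
    have h1 : ∀ x, (cintegral ν fun y => E.indicator (fun _ => c) (x * y)) =
        c * ν ((x * ·) ⁻¹' E) := fun x =>
      cintegral_indicator (measurable_const_mul x hE) c
    simp_rw [h1]
    have hmeas := measurable_complex_translate ν hE
    refine ⟨hmeas.const_mul c, ?_⟩
    rw [cintegral_indicator hE, conv_apply μ ν hE,
      cintegral_const_mul (integrable_of_bound hmeas fun x => norm_translate_le ν _)]
  · rintro f g hf hg ⟨C, hC⟩ ⟨D, hD⟩ ⟨h1, h2⟩ ⟨h3, h4⟩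
    have h5 : ∀ x, (cintegral ν fun y => f (x * y) + g (x * y)) =
        (cintegral ν fun y => f (x * y)) + cintegral ν fun y => g (x * y) := fun x =>
      cintegral_add (integrable_of_bound (hm hf x) fun y => hC _)
        (integrable_of_bound (hm hg x) fun y => hD _)
    simp_rw [h5]
    refine ⟨h1.add h3, ?_⟩
    rw [cintegral_add (integrable_of_bound hf hC) (integrable_of_bound hg hD), h2, h4,
      cintegral_add (integrable_of_bound h1 fun x => norm_cintegral_le fun y => hC _)
        (integrable_of_bound h3 fun x => norm_cintegral_le fun y => hD _)]
  · intro F f C hF hC hlim h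
    have hx : ∀ x, Tendsto (fun n => cintegral ν fun y => F n (x * y)) atTop
        (𝓝 (cintegral ν fun y => f (x * y))) := fun x =>
      tendsto_cintegral (fun n => hm (hF n) x) (fun n y => hC n _) fun y => hlim _
    refine ⟨measurable_of_tendsto_metrizable (fun n => (h n).1) (tendsto_pi_nhds.2 hx), ?_⟩
    refine tendsto_nhds_unique (tendsto_cintegral (μ := conv μ ν) hF hC hlim) ?_
    simp_rw [(h _).2]
    exact tendsto_cintegral (fun n => (h n).1) (fun n x => norm_cintegral_le fun y => hC n _) hx

theorem conv_assoc (ρ : ComplexMeasure G) [IsFiniteMeasure ρ.variation] [ρ.variation.Regular]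
    [IsFiniteMeasure (conv μ ν).variation] [IsFiniteMeasure (conv ν ρ).variation]
    [(conv ν ρ).variation.Regular] :
    conv (conv μ ν) ρ = conv μ (conv ν ρ) := by
  ext E hE
  rw [conv_apply _ _ hE, conv_apply _ _ hE,
    (cintegral_conv μ ν (measurable_complex_translate ρ hE) fun x => norm_translate_le ρ _).2]
  congr 1
  ext x
  rw [conv_apply ν ρ (measurable_const_mul x hE)]
  congr 1
  ext y
  rw [preimage_preimage]
  simp only [mul_assoc]

end conv

end Complex


/-- A weight on `G`: a Borel measurable function `ω ≥ 1` with `ω (x y) ≤ ω x * ω y`. -/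
structure Weight (G : Type*) [Group G] [MeasurableSpace G] where
  toFun : G → ℝ
  measurable' : Measurable toFun
  one_le' : ∀ x, 1 ≤ toFun x
  mul_le' : ∀ x y, toFun (x * y) ≤ toFun x * toFun y

instance {G : Type*} [Group G] [MeasurableSpace G] : CoeFun (Weight G) fun _ => G → ℝ :=
  ⟨Weight.toFun⟩

section Algebra

variable {G : Type*} [Group G] [TopologicalSpace G] [IsTopologicalGroup G]
  [LocallyCompactSpace G] [T2Space G] [MeasurableSpace G] [BorelSpace G] (ω : Weight G)

theorem isFinite_of_integrable {m : Measure G} (h : Integrable ω m) : IsFiniteMeasure m := by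
  have h1 : Integrable (fun _ : G => (1 : ℝ)) m :=
    h.mono' aestronglyMeasurable_const (Eventually.of_forall fun x => by simpa using ω.one_le' x)
  simpa [integrable_const_iff] using h1

/-- The space `M_b(G, ω)` of complex regular Borel measures `μ` on `G` with
`∫ ω d|μ| < ∞`. Since `ω ≥ 1`, such a measure has finite total variation. -/
def weightedMeasures : Submodule ℂ (ComplexMeasure G) where
  carrier := {μ | μ.variation.Regular ∧ Integrable ω μ.variation}
  zero_mem' := by
    simp only [mem_ofPred_eq, VectorMeasure.variation_zero]
    exact ⟨inferInstance, integrable_zero_measure⟩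
  add_mem' := by
    rintro μ ν ⟨h1, h2⟩ ⟨h3, h4⟩
    have := isFinite_of_integrable ω h2
    have := isFinite_of_integrable ω h4
    have hle := VectorMeasure.variation_add_le (μ := μ) (ν := ν)
    have := isFiniteMeasure_of_le _ hle
    have := innerRegular_of_le hle
    exact ⟨inferInstance, (h2.add_measure h4).mono_measure hle⟩
  smul_mem' := by
    rintro c μ ⟨h1, h2⟩
    simp only [mem_ofPred_eq, VectorMeasure.variation_smul]
    exact ⟨inferInstance, h2.smul_measure_nnreal⟩

/-- The weighted measure algebra `M_b(G, ω)`. It is a Banach algebra with the norm `‖μ‖ = ∫ ω d|μ|` and the convolution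
product `conv`. -/
def WeightedMeasureAlgebra : Type _ := weightedMeasures ω

namespace WeightedMeasureAlgebra

variable {ω}

/-- The complex measure underlying an element of `M_b(G, ω)`. -/
def toMeasure (μ : WeightedMeasureAlgebra ω) : ComplexMeasure G := μ.1

instance : AddCommGroup (WeightedMeasureAlgebra ω) :=
  inferInstanceAs (AddCommGroup (weightedMeasures ω))

instance : Module ℂ (WeightedMeasureAlgebra ω) :=
  inferInstanceAs (Module ℂ (weightedMeasures ω))

@[ext] theorem ext {μ ν : WeightedMeasureAlgebra ω} (h : μ.toMeasure = ν.toMeasure) : μ = ν :=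
  Subtype.ext h

@[simp] theorem toMeasure_zero : (0 : WeightedMeasureAlgebra ω).toMeasure = 0 := rfl
@[simp] theorem toMeasure_add (μ ν : WeightedMeasureAlgebra ω) :
    (μ + ν).toMeasure = μ.toMeasure + ν.toMeasure := rfl
@[simp] theorem toMeasure_sub (μ ν : WeightedMeasureAlgebra ω) :
    (μ - ν).toMeasure = μ.toMeasure - ν.toMeasure := rfl
@[simp] theorem toMeasure_neg (μ : WeightedMeasureAlgebra ω) :
    (-μ).toMeasure = -μ.toMeasure := rfl
@[simp] theorem toMeasure_smul (c : ℂ) (μ : WeightedMeasureAlgebra ω) :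
    (c • μ).toMeasure = c • μ.toMeasure := rfl
theorem toMeasure_sum {ι : Type*} (s : Finset ι) (f : ι → WeightedMeasureAlgebra ω) :
    (∑ i ∈ s, f i).toMeasure = ∑ i ∈ s, (f i).toMeasure :=
  map_sum (weightedMeasures ω).subtype f s

instance (μ : WeightedMeasureAlgebra ω) : μ.toMeasure.variation.Regular := μ.2.1

theorem integrable_weight (μ : WeightedMeasureAlgebra ω) : Integrable ω μ.toMeasure.variation :=
  μ.2.2

instance (μ : WeightedMeasureAlgebra ω) : IsFiniteMeasure μ.toMeasure.variation :=
  isFinite_of_integrable ω μ.integrable_weight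

instance : Norm (WeightedMeasureAlgebra ω) := ⟨fun μ => ∫ x, ω x ∂μ.toMeasure.variation⟩

theorem norm_def (μ : WeightedMeasureAlgebra ω) : ‖μ‖ = ∫ x, ω x ∂μ.toMeasure.variation := rfl

theorem weight_nonneg (x : G) : 0 ≤ ω x := zero_le_one.trans (ω.one_le' x)

theorem variation_le_norm (μ : WeightedMeasureAlgebra ω) :
    μ.toMeasure.variation.real univ ≤ ‖μ‖ := by
  have : ∫ _, (1 : ℝ) ∂μ.toMeasure.variation ≤ ‖μ‖ :=
    integral_mono (integrable_const _) μ.integrable_weight ω.one_le'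
  simpa using this

theorem norm_le_of_le {μ : WeightedMeasureAlgebra ω} {m : Measure G} (hm : Integrable ω m)
    (h : μ.toMeasure.variation ≤ m) : ‖μ‖ ≤ ∫ x, ω x ∂m :=
  integral_mono_measure h (Eventually.of_forall weight_nonneg) hm

theorem normedSpaceCore : NormedSpace.Core ℂ (WeightedMeasureAlgebra ω) where
  norm_nonneg _ := integral_nonneg weight_nonneg
  norm_smul c μ := by
    rw [norm_def, norm_def, toMeasure_smul, VectorMeasure.variation_smul,
      integral_smul_nnreal_measure]
    rfl
  norm_triangle μ ν := by
    rw [norm_def μ, norm_def ν, ← integral_add_measure μ.integrable_weight ν.integrable_weight]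
    exact norm_le_of_le (μ.integrable_weight.add_measure ν.integrable_weight)
      VectorMeasure.variation_add_le
  norm_eq_zero_iff μ := by
    refine ⟨fun h => ?_, fun h => by simp [norm_def, h]⟩
    have h1 := variation_le_norm μ
    rw [h] at h1
    have h2 : μ.toMeasure.variation.real univ = 0 := le_antisymm h1 measureReal_nonneg
    rw [measureReal_eq_zero_iff, Measure.measure_univ_eq_zero,
      VectorMeasure.variation_eq_zero] at h2
    exact ext h2

instance instNACG : NormedAddCommGroup (WeightedMeasureAlgebra ω) :=
  NormedAddCommGroup.ofCore normedSpaceCore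

instance : NormedSpace ℂ (WeightedMeasureAlgebra ω) := NormedSpace.ofCore normedSpaceCore

theorem integrable_posConv (μ ν : WeightedMeasureAlgebra ω) :
    Integrable ω (posConv μ.toMeasure.variation ν.toMeasure.variation) ∧
      ∫ x, ω x ∂(posConv μ.toMeasure.variation ν.toMeasure.variation) ≤ ‖μ‖ * ‖ν‖ := by
  have hlin : ∀ ρ : WeightedMeasureAlgebra ω,
      ∫⁻ x, ENNReal.ofReal (ω x) ∂ρ.toMeasure.variation = ENNReal.ofReal ‖ρ‖ := fun ρ =>
    (ofReal_integral_eq_lintegral_ofReal ρ.integrable_weight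
      (Eventually.of_forall weight_nonneg)).symm
  have hm : Measurable fun x => ENNReal.ofReal (ω x) := ω.measurable'.ennreal_ofReal
  have hle : ∫⁻ z, ENNReal.ofReal (ω z) ∂(posConv μ.toMeasure.variation ν.toMeasure.variation) ≤
      ENNReal.ofReal (‖μ‖ * ‖ν‖) := by
    rw [lintegral_posConv _ _ hm, ENNReal.ofReal_mul (norm_nonneg _), ← hlin, ← hlin,
      ← lintegral_mul_const _ hm]
    refine lintegral_mono fun x => ?_
    rw [← lintegral_const_mul _ hm]
    refine lintegral_mono fun y => ?_
    rw [← ENNReal.ofReal_mul (weight_nonneg x)]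
    exact ENNReal.ofReal_le_ofReal (ω.mul_le' x y)
  have hint : Integrable ω (posConv μ.toMeasure.variation ν.toMeasure.variation) := by
    refine ⟨ω.measurable'.aestronglyMeasurable, ?_⟩
    rw [hasFiniteIntegral_iff_ofReal (Eventually.of_forall weight_nonneg)]
    exact hle.trans_lt ENNReal.ofReal_lt_top
  refine ⟨hint, ?_⟩
  rw [integral_eq_lintegral_of_nonneg_ae (Eventually.of_forall weight_nonneg)
    ω.measurable'.aestronglyMeasurable]
  exact ENNReal.toReal_le_of_le_ofReal (by positivity) hle

instance : Mul (WeightedMeasureAlgebra ω) :=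
  ⟨fun μ ν => ⟨conv μ.toMeasure ν.toMeasure, regular_conv _ _,
    (integrable_posConv μ ν).1.mono_measure (variation_conv_le _ _)⟩⟩

theorem toMeasure_mul (μ ν : WeightedMeasureAlgebra ω) :
    (μ * ν).toMeasure = conv μ.toMeasure ν.toMeasure := rfl

theorem mul_apply (μ ν : WeightedMeasureAlgebra ω) {E : Set G} (hE : MeasurableSet E) :
    (μ * ν).toMeasure E = cintegral μ.toMeasure fun x => ν.toMeasure ((x * ·) ⁻¹' E) :=
  conv_apply _ _ hE

theorem integrable_translate (μ ν : WeightedMeasureAlgebra ω) {E : Set G} (hE : MeasurableSet E) :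
    Integrable (fun x => ν.toMeasure ((x * ·) ⁻¹' E)) μ.toMeasure.variation :=
  integrable_of_bound (measurable_complex_translate _ hE) fun _ => norm_translate_le _ _

instance instNUR : NonUnitalRing (WeightedMeasureAlgebra ω) where
  left_distrib μ ν ρ := by
    ext E hE
    rw [toMeasure_add, _root_.add_apply, mul_apply _ _ hE, mul_apply _ _ hE, mul_apply _ _ hE,
      ← cintegral_add (integrable_translate μ ν hE) (integrable_translate μ ρ hE)]
    rfl
  right_distrib μ ν ρ := by
    ext E hE
    rw [toMeasure_add, _root_.add_apply, mul_apply _ _ hE, mul_apply _ _ hE, mul_apply _ _ hE,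
      toMeasure_add,
      cintegral_add_measure (integrable_translate μ ρ hE) (integrable_translate ν ρ hE)]
  zero_mul μ := by
    ext E hE
    rw [mul_apply _ _ hE]
    exact VectorMeasure.integral_zero_vectorMeasure
  mul_zero μ := by
    ext E hE
    rw [mul_apply _ _ hE]
    exact VectorMeasure.integral_zero
  mul_assoc μ ν ρ := by
    have := isFinite_conv μ.toMeasure ν.toMeasure
    have := isFinite_conv ν.toMeasure ρ.toMeasure
    have := regular_conv ν.toMeasure ρ.toMeasure
    exact ext (conv_assoc _ _ _)

theorem norm_mul_le' (μ ν : WeightedMeasureAlgebra ω) : ‖μ * ν‖ ≤ ‖μ‖ * ‖ν‖ := by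
  obtain ⟨h1, h2⟩ := integrable_posConv μ ν
  have h3 : (μ * ν).toMeasure.variation ≤
      posConv μ.toMeasure.variation ν.toMeasure.variation := by
    rw [toMeasure_mul]
    exact variation_conv_le _ _
  exact (norm_le_of_le h1 h3).trans h2

instance : NonUnitalNormedRing (WeightedMeasureAlgebra ω) where
  __ := instNACG
  __ := instNUR
  norm_mul_le := norm_mul_le'

instance : IsScalarTower ℂ (WeightedMeasureAlgebra ω) (WeightedMeasureAlgebra ω) where
  smul_assoc c μ ν := by
    ext E hE
    simp only [smul_eq_mul, toMeasure_smul]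
    rw [_root_.smul_apply, mul_apply _ _ hE, mul_apply _ _ hE, toMeasure_smul, smul_eq_mul]
    exact cintegral_smul_measure (measurable_complex_translate _ hE)
      (fun _ => norm_translate_le _ _) c

instance : SMulCommClass ℂ (WeightedMeasureAlgebra ω) (WeightedMeasureAlgebra ω) where
  smul_comm c μ ν := by
    ext E hE
    simp only [smul_eq_mul, toMeasure_smul]
    rw [_root_.smul_apply, mul_apply _ _ hE, mul_apply _ _ hE, toMeasure_smul, smul_eq_mul]
    exact (cintegral_const_mul (integrable_translate μ ν hE) c).symm

theorem norm_apply_le (μ : WeightedMeasureAlgebra ω) (E : Set G) : ‖μ.toMeasure E‖ ≤ ‖μ‖ :=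
  (norm_translate_le _ E).trans (variation_le_norm μ)

open scoped Classical in
instance : CompleteSpace (WeightedMeasureAlgebra ω) := by
  refine NormedAddCommGroup.completeSpace_of_summable_imp_tendsto fun u hu => ?_
  -- the dominating measures `∑_{n ≥ N} |u n|`
  let M : ℕ → Measure G := fun N => Measure.sum fun n => (u (n + N)).toMeasure.variation
  have hu' : ∀ N, Summable fun n => ‖u (n + N)‖ := fun N => (summable_nat_add_iff N).2 hu
  have hMint : ∀ N, Integrable ω (M N) := fun N => by
    refine integrable_sum_measure (fun n => (u (n + N)).integrable_weight) ?_
    refine (hu' N).congr fun n => ?_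
    rw [norm_def]
    refine integral_congr_ae (Eventually.of_forall fun x => ?_)
    exact (Real.norm_of_nonneg (weight_nonneg x)).symm
  have hMfin : ∀ N, IsFiniteMeasure (M N) := fun N => isFinite_of_integrable ω (hMint N)
  have hMval : ∀ N, ∫ x, ω x ∂(M N) = ∑' n, ‖u (n + N)‖ := fun N =>
    (hasSum_integral_measure (hMint N)).tsum_eq.symm
  have hMreg : (M 0).InnerRegular := inferInstance
  have hsE : ∀ N (E : Set G), Summable fun n => (u (n + N)).toMeasure E := fun N E =>
    Summable.of_norm_bounded (hu' N) fun n => norm_apply_le _ _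
  have hbound : ∀ N (E : Set G), ‖∑' n, (u (n + N)).toMeasure E‖ₑ ≤ M N E := fun N E => by
    refine enorm_tsum_le_tsum_enorm.trans ((ENNReal.tsum_le_tsum fun n =>
      VectorMeasure.enorm_measure_le_variation _ _).trans (Measure.le_sum_apply _ _))
  let v : ComplexMeasure G := VectorMeasure.of_additive_of_le_measure (μ := M 0)
    (fun E => ∑' n, (u (n + 0)).toMeasure E) (hbound 0)
    (fun E F hE hF hEF => by
      rw [← (hsE 0 E).tsum_add (hsE 0 F)]
      exact tsum_congr fun n => VectorMeasure.of_union hEF hE hF)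
    (fun E hE => by simp [VectorMeasure.not_measurable _ hE])
  have hv : ∀ E, v E = ∑' n, (u n).toMeasure E := fun E => rfl
  have hvle : v.variation ≤ M 0 :=
    VectorMeasure.variation_le_of_forall_enorm_le fun E _ => hbound 0 E
  have hvreg : v.variation.Regular := by
    have := isFiniteMeasure_of_le _ hvle
    have := innerRegular_of_le hvle
    infer_instance
  let w : WeightedMeasureAlgebra ω := ⟨v, hvreg, (hMint 0).mono_measure hvle⟩
  have hw : w.toMeasure = v := rfl
  refine ⟨w, ?_⟩
  rw [tendsto_iff_norm_sub_tendsto_zero]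
  refine squeeze_zero (fun _ => norm_nonneg _) (fun N => ?_)
    (tendsto_sum_nat_add fun n => ‖u n‖)
  rw [← hMval N, norm_sub_rev]
  refine norm_le_of_le (hMint N) ?_
  refine VectorMeasure.variation_le_of_forall_enorm_le fun E _ => ?_
  refine le_trans (le_of_eq ?_) (hbound N E)
  congr 1
  rw [toMeasure_sub, _root_.sub_apply, hw, hv, toMeasure_sum,
    ← (show Summable fun n => (u n).toMeasure E from hsE 0 E).sum_add_tsum_nat_add N]
  have hsum : (∑ i ∈ Finset.range N, (u i).toMeasure) E =
      ∑ i ∈ Finset.range N, (u i).toMeasure E := by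
    rw [_root_.sum_apply]
  rw [hsum, add_sub_cancel_left]

end WeightedMeasureAlgebra

end Algebra

section WAP

variable (A : Type*) [NonUnitalNormedRing A] [NormedSpace ℂ A] [IsScalarTower ℂ A A]
  [SMulCommClass ℂ A A]

variable {A} in
/-- The functional `f · a`, given by `⟨f · a, b⟩ = ⟨f, a b⟩`. -/
def dualAct (f : StrongDual ℂ A) (a : A) : StrongDual ℂ A :=
  f.comp (ContinuousLinearMap.mul ℂ A a)

variable {A} in
/-- `f` is weakly almost periodic: `{f · a : ‖a‖ ≤ 1}` is relatively weakly compact in `A*`. -/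
def IsWeaklyAlmostPeriodic (f : StrongDual ℂ A) : Prop :=
  IsCompact (closure ((fun a => toWeakSpace ℂ (StrongDual ℂ A) (dualAct f a)) '' {a | ‖a‖ ≤ 1}))

/-- The subspace `WAP(A)` of the weakly almost periodic functionals. -/
def wap : Submodule ℂ (StrongDual ℂ A) where
  carrier := {f | IsWeaklyAlmostPeriodic f}
  zero_mem' := by
    refine IsCompact.closure_of_subset (K := {0}) isCompact_singleton ?_
    rintro _ ⟨a, -, rfl⟩
    simp [dualAct]
  add_mem' := by
    intro f g hf hg
    refine IsCompact.closure_of_subset (hf.add hg) ?_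
    rintro _ ⟨a, ha, rfl⟩
    exact ⟨_, subset_closure ⟨a, ha, rfl⟩, _, subset_closure ⟨a, ha, rfl⟩, rfl⟩
  smul_mem' := by
    intro c f hf
    refine IsCompact.closure_of_subset (hf.image (continuous_const_smul c)) ?_
    rintro _ ⟨a, ha, rfl⟩
    exact ⟨_, subset_closure ⟨a, ha, rfl⟩, rfl⟩

/-- `WAP(A)` as a normed space, with the norm of `A*`. -/
def WAP : Type _ := wap A

instance : NormedAddCommGroup (WAP A) := inferInstanceAs (NormedAddCommGroup (wap A))

instance : NormedSpace ℂ (WAP A) := inferInstanceAs (NormedSpace ℂ (wap A))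

/-- The inclusion `WAP(A) → A*`. -/
def WAP.incl : WAP A →ₗᵢ[ℂ] StrongDual ℂ A := (wap A).subtypeₗᵢ

/-- The natural map `A → WAP(A)*`, `a ↦ (f ↦ ⟨f, a⟩)`. -/
def toWapDual : A →L[ℂ] StrongDual ℂ (WAP A) :=
  (WAP.incl A).toContinuousLinearMap.precomp ℂ ∘L NormedSpace.inclusionInDoubleDual ℂ A

theorem toWapDual_apply (a : A) (f : WAP A) : toWapDual A a f = WAP.incl A f a :=
  rfl

/-- A Banach algebra `A` is a WAP-algebra if the natural map `A → WAP(A)*` is bounded below,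
that is, if the infimum of its norm over `{a : ‖a‖ ≥ 1}` is positive. -/
def IsWAPAlgebra [CompleteSpace A] : Prop :=
  ∃ c : ℝ, 0 < c ∧ ∀ a : A, 1 ≤ ‖a‖ → c ≤ ‖toWapDual A a‖

end WAP

end WeightedConvolution
end

/-!
The functionals `⟨h, μ⟩ = ∫ h dμ` with `h` continuous and compactly supported are weakly almost
periodic, and those with `|h| ≤ ω` already norm `M_b(G, ω)` up to a constant factor.

*Weak almost periodicity.* For a positive measure `p`, the functional `h · p` is the average
`∫ h_x dp(x)` of the translates `h_x(y) = h(xy)` (`dualAct_pairing_toAlgebra`). Hence for `Ψ` in the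
bidual, `Ψ(h · p) = ∫ Ψ(h_x) dp(x)`. The function `x ↦ Ψ(h_x)` is continuous, and it vanishes at
infinity: otherwise there would be infinitely many translates with disjoint supports on which `Ψ`
is bounded away from `0`, and unimodular combinations of them, which stay bounded by `‖h‖`, would
make `Ψ` unbounded (`exists_isCompact_translate_lt`). The positive measures with `∫ ω dp ≤ 1` are
compact with respect to integration against functions vanishing at infinity, by the
Riesz–Markov–Kakutani theorem (`exists_vague_limit`, `tendsto_integral_of_vague`); continuity of `ω`
is used to see that the limit stays in the ball. So `p ↦ h · p` has a weakly compact image on this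
ball. By the Jordan decomposition each `h · μ` with `‖μ‖ ≤ 1` is a fixed linear combination of four
points of this image (`isWeaklyAlmostPeriodic_pairing`).

*Norming.* If `‖μ‖ ≥ 1`, one of the four positive parts of `μ` has weighted mass at least `1/4`.
It is carried by a set which is null for the part of opposite sign, and a bump function at a large
compact subset of that set, multiplied by `ω`, gives `h` with `|∫ h dμ| ≥ 1/8`
(`exists_pairing_ge`). This step again uses that `ω` is continuous.
-/

noncomputable section

namespace WeightedConvolution

open MeasureTheory Filter Topology Set
open scoped ENNReal BoundedContinuousFunction CompactlySupported Pointwise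

variable {G : Type*} [Group G] [TopologicalSpace G] [IsTopologicalGroup G]
  [LocallyCompactSpace G] [T2Space G] [MeasurableSpace G] [BorelSpace G] {ω : Weight G}

/-! ### Positive elements of the algebra -/

/-- A positive finite measure, viewed as a complex measure. -/
def complexOfMeasure (p : Measure G) [IsFiniteMeasure p] : ComplexMeasure G :=
  SignedMeasure.toComplexMeasure p.toSignedMeasure 0

theorem complexOfMeasure_apply (p : Measure G) [IsFiniteMeasure p] {E : Set G}
    (hE : MeasurableSet E) : complexOfMeasure p E = (p.real E : ℂ) := by
  rw [complexOfMeasure, SignedMeasure.toComplexMeasure_apply,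
    Measure.toSignedMeasure_apply_measurable hE]
  rfl

theorem variation_complexOfMeasure_le (p : Measure G) [IsFiniteMeasure p] :
    (complexOfMeasure p).variation ≤ p := by
  refine VectorMeasure.variation_le_of_forall_enorm_le fun E hE => ?_
  rw [complexOfMeasure_apply p hE, ← ofReal_norm, Complex.norm_real,
    Real.norm_of_nonneg measureReal_nonneg, ofReal_measureReal]

theorem cintegral_complexOfMeasure (p : Measure G) [IsFiniteMeasure p] {f : G → ℂ}
    (hf : Measurable f) {C : ℝ} (hC : ∀ x, ‖f x‖ ≤ C) :
    cintegral (complexOfMeasure p) f = ∫ x, f x ∂p := by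
  have hfin := isFiniteMeasure_of_le p (variation_complexOfMeasure_le p)
  refine bounded_induction (P := fun f => cintegral (complexOfMeasure p) f = ∫ x, f x ∂p)
    ?_ ?_ ?_ hf hC
  · intro c E hE
    rw [cintegral_indicator hE, complexOfMeasure_apply p hE, integral_indicator_const c hE,
      Complex.real_smul, mul_comm]
  · rintro f g hf hg ⟨C, hC⟩ ⟨D, hD⟩ h1 h2
    rw [cintegral_add (integrable_of_bound hf hC) (integrable_of_bound hg hD), h1, h2,
      integral_add (Integrable.of_bound hf.aestronglyMeasurable C (Eventually.of_forall hC))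
        (Integrable.of_bound hg.aestronglyMeasurable D (Eventually.of_forall hD))]
  · intro F f C hF hC hlim h
    refine tendsto_nhds_unique (tendsto_cintegral hF hC hlim) ?_
    simp_rw [h]
    exact tendsto_integral_of_dominated_convergence (fun _ => C)
      (fun n => (hF n).aestronglyMeasurable) (integrable_const C)
      (fun n => Eventually.of_forall (hC n)) (Eventually.of_forall hlim)

variable (ω) in
/-- The positive cone of `M_b(G, ω)`: positive regular measures `p` with `∫ ω dp < ∞`. -/
structure PosMeasure where
  /-- The underlying positive measure. -/
  measure : Measure G
  regular : measure.Regular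
  integrable : Integrable ω measure

namespace PosMeasure

instance (p : PosMeasure ω) : p.measure.Regular := p.regular

instance (p : PosMeasure ω) : IsFiniteMeasure p.measure := isFinite_of_integrable ω p.integrable

/-- A measure of the positive cone as an element of the algebra `M_b(G, ω)`. -/
def toAlgebra (p : PosMeasure ω) : WeightedMeasureAlgebra ω :=
  ⟨complexOfMeasure p.measure, by
    have := innerRegular_of_le (variation_complexOfMeasure_le p.measure)
    have := isFiniteMeasure_of_le _ (variation_complexOfMeasure_le p.measure)
    infer_instance, p.integrable.mono_measure (variation_complexOfMeasure_le p.measure)⟩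

theorem toMeasure_toAlgebra (p : PosMeasure ω) :
    p.toAlgebra.toMeasure = complexOfMeasure p.measure := rfl

theorem norm_toAlgebra_le (p : PosMeasure ω) : ‖p.toAlgebra‖ ≤ ∫ x, ω x ∂p.measure :=
  WeightedMeasureAlgebra.norm_le_of_le p.integrable (variation_complexOfMeasure_le p.measure)

theorem measureReal_univ_le (p : PosMeasure ω) : p.measure.real univ ≤ ∫ x, ω x ∂p.measure := by
  have : ∫ _, (1 : ℝ) ∂p.measure ≤ ∫ x, ω x ∂p.measure :=
    integral_mono (integrable_const _) p.integrable ω.one_le'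
  simpa using this

theorem integral_le_norm {p : PosMeasure ω} {μ : WeightedMeasureAlgebra ω}
    (h : p.measure ≤ μ.toMeasure.variation) : ∫ x, ω x ∂p.measure ≤ ‖μ‖ :=
  integral_mono_measure h (Eventually.of_forall WeightedMeasureAlgebra.weight_nonneg)
    μ.integrable_weight

theorem cintegral_toAlgebra (p : PosMeasure ω) {f : G → ℂ} (hf : Measurable f) {C : ℝ}
    (hC : ∀ x, ‖f x‖ ≤ C) : cintegral p.toAlgebra.toMeasure f = ∫ x, f x ∂p.measure :=
  cintegral_complexOfMeasure p.measure hf hC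

end PosMeasure

/-- The Jordan decomposition of a signed measure dominated by an element of `M_b(G, ω)`. -/
theorem exists_posMeasure_of_signed {μ : WeightedMeasureAlgebra ω} {s : SignedMeasure G}
    (hs : s.variation ≤ μ.toMeasure.variation) :
    ∃ p q : PosMeasure ω, p.measure ⟂ₘ q.measure ∧ p.measure ≤ μ.toMeasure.variation ∧
      q.measure ≤ μ.toMeasure.variation ∧
      ∀ E, MeasurableSet E → s E = p.measure.real E - q.measure.real E := by
  have part : ∀ p : Measure G, p ≤ s.totalVariation →
      ∃ P : PosMeasure ω, P.measure = p ∧ p ≤ μ.toMeasure.variation := by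
    intro p hp
    rw [SignedMeasure.totalVariation_eq_variation] at hp
    have hle := hp.trans hs
    have : p.InnerRegular := innerRegular_of_le hle
    have := isFiniteMeasure_of_le _ hle
    exact ⟨⟨p, inferInstance, μ.integrable_weight.mono_measure hle⟩, rfl, hle⟩
  obtain ⟨p, hp, hp'⟩ := part s.toJordanDecomposition.posPart (by
    rw [SignedMeasure.totalVariation]; exact Measure.le_add_right le_rfl)
  obtain ⟨q, hq, hq'⟩ := part s.toJordanDecomposition.negPart (by
    rw [SignedMeasure.totalVariation]; exact Measure.le_add_left le_rfl)
  refine ⟨p, q, ?_, by rwa [hp], by rwa [hq], fun E hE => ?_⟩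
  · rw [hp, hq]
    exact s.toJordanDecomposition.mutuallySingular
  · rw [hp, hq]
    conv_lhs => rw [← SignedMeasure.toSignedMeasure_toJordanDecomposition s]
    rw [JordanDecomposition.toSignedMeasure, _root_.sub_apply,
      Measure.toSignedMeasure_apply_measurable hE, Measure.toSignedMeasure_apply_measurable hE]

/-- The Jordan decompositions of the real and imaginary parts. -/
theorem exists_posMeasure_decomposition (μ : WeightedMeasureAlgebra ω) :
    ∃ p q r s : PosMeasure ω, p.measure ⟂ₘ q.measure ∧ r.measure ⟂ₘ s.measure ∧
      p.measure ≤ μ.toMeasure.variation ∧ q.measure ≤ μ.toMeasure.variation ∧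
      r.measure ≤ μ.toMeasure.variation ∧ s.measure ≤ μ.toMeasure.variation ∧
      μ = (p.toAlgebra - q.toAlgebra) + Complex.I • (r.toAlgebra - s.toAlgebra) := by
  obtain ⟨p, q, hpq, hp, hq, h1⟩ := exists_posMeasure_of_signed (μ := μ)
    (s := ComplexMeasure.re μ.toMeasure)
    (VectorMeasure.variation_le_of_forall_enorm_le fun F _ =>
      (enorm_le_iff_norm_le.2 (Complex.abs_re_le_norm _)).trans
        (VectorMeasure.enorm_measure_le_variation μ.toMeasure F))
  obtain ⟨r, s, hrs, hr, hs, h2⟩ := exists_posMeasure_of_signed (μ := μ)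
    (s := ComplexMeasure.im μ.toMeasure)
    (VectorMeasure.variation_le_of_forall_enorm_le fun F _ =>
      (enorm_le_iff_norm_le.2 (Complex.abs_im_le_norm _)).trans
        (VectorMeasure.enorm_measure_le_variation μ.toMeasure F))
  refine ⟨p, q, r, s, hpq, hrs, hp, hq, hr, hs, ?_⟩
  ext E hE
  have e1 : (μ.toMeasure E).re = p.measure.real E - q.measure.real E := h1 E hE
  have e2 : (μ.toMeasure E).im = r.measure.real E - s.measure.real E := h2 E hE
  simp only [WeightedMeasureAlgebra.toMeasure_add, WeightedMeasureAlgebra.toMeasure_sub,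
    WeightedMeasureAlgebra.toMeasure_smul, PosMeasure.toMeasure_toAlgebra]
  rw [_root_.add_apply, _root_.smul_apply, _root_.sub_apply, _root_.sub_apply,
    complexOfMeasure_apply _ hE, complexOfMeasure_apply _ hE, complexOfMeasure_apply _ hE,
    complexOfMeasure_apply _ hE, ← Complex.re_add_im (μ.toMeasure E), e1, e2]
  push_cast
  rw [smul_eq_mul, mul_comm Complex.I]

/-- A finite regular measure is carried by an increasing sequence of compact sets. -/
theorem exists_isCompact_iUnion_ae (p : Measure G) [IsFiniteMeasure p] [p.Regular] :
    ∃ K : ℕ → Set G, Monotone K ∧ (∀ n, IsCompact (K n)) ∧ p (⋃ n, K n)ᶜ = 0 := by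
  have h : ∀ n : ℕ, ∃ K : Set G, IsCompact K ∧ p Kᶜ < ((n : ℝ≥0∞) + 1)⁻¹ := fun n => by
    obtain ⟨K, -, hK, hlt⟩ := (MeasurableSet.univ (α := G)).exists_isCompact_sdiff_lt
      (measure_ne_top p univ) (ε := ((n : ℝ≥0∞) + 1)⁻¹) (by simp)
    exact ⟨K, hK, by rwa [← compl_eq_univ_sdiff] at hlt⟩
  choose K hK hlt using h
  refine ⟨accumulate K, monotone_accumulate,
    fun n => (finite_Iic n).isCompact_biUnion fun i _ => hK i, ?_⟩
  rw [iUnion_accumulate]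
  refine le_antisymm (ENNReal.le_of_forall_pos_le_add fun ε hε _ => ?_) bot_le
  obtain ⟨n, hn⟩ := ENNReal.exists_inv_nat_lt (ENNReal.coe_pos.2 hε).ne'
  rw [zero_add]
  refine (measure_mono (compl_subset_compl.2 (subset_iUnion K n))).trans ((hlt n).le.trans ?_)
  exact (ENNReal.inv_le_inv.2 le_self_add).trans hn.le

/-- A continuous function is almost everywhere strongly measurable for a finite regular measure,
even if its range is not separable: it has separable range on a set of full measure. -/
theorem aestronglyMeasurable_of_continuous {E : Type*} [TopologicalSpace E]
    [TopologicalSpace.PseudoMetrizableSpace E] (p : Measure G) [IsFiniteMeasure p] [p.Regular]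
    {F : G → E} (hF : Continuous F) : AEStronglyMeasurable F p := by
  obtain ⟨K, -, hK, h0⟩ := exists_isCompact_iUnion_ae p
  have h1 : p.restrict (⋃ n, K n) = p := by
    rw [Measure.restrict_eq_self_of_ae_mem]
    rw [ae_iff]
    exact h0
  rw [← h1, aestronglyMeasurable_iUnion_iff]
  exact fun n => hF.continuousOn.aestronglyMeasurable_of_isCompact (hK n) (hK n).measurableSet

/-! ### Functionals given by bounded continuous functions -/

theorem integrable_boundedContinuous (h : G →ᵇ ℂ) (μ : WeightedMeasureAlgebra ω) :
    Integrable h μ.toMeasure.variation :=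
  integrable_of_bound h.continuous.measurable h.norm_coe_le_norm

/-- The pairing `⟨h, μ⟩ = ∫ h dμ`, as a map from bounded continuous functions into the dual of
`M_b(G, ω)`. -/
def pairing (ω : Weight G) : (G →ᵇ ℂ) →L[ℂ] StrongDual ℂ (WeightedMeasureAlgebra ω) :=
  LinearMap.mkContinuous₂
    (LinearMap.mk₂ ℂ (fun (h : G →ᵇ ℂ) (μ : WeightedMeasureAlgebra ω) => cintegral μ.toMeasure h)
      (fun h k μ => cintegral_add (integrable_boundedContinuous h μ)
        (integrable_boundedContinuous k μ))
      (fun c h μ => cintegral_const_mul (integrable_boundedContinuous h μ) c)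
      (fun h μ ν => cintegral_add_measure (integrable_boundedContinuous h μ)
        (integrable_boundedContinuous h ν))
      (fun c h μ => cintegral_smul_measure (μ := μ.toMeasure) h.continuous.measurable
        h.norm_coe_le_norm c))
    1 fun h μ => by
      rw [one_mul]
      exact (norm_cintegral_le h.norm_coe_le_norm).trans
        (mul_le_mul_of_nonneg_left (WeightedMeasureAlgebra.variation_le_norm μ) (norm_nonneg h))

theorem pairing_apply (h : G →ᵇ ℂ) (μ : WeightedMeasureAlgebra ω) :
    pairing ω h μ = cintegral μ.toMeasure h := rfl

theorem norm_pairing_le_one {h : G →ᵇ ℂ} (hh : ∀ x, ‖h x‖ ≤ ω x) : ‖pairing ω h‖ ≤ 1 := by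
  refine ContinuousLinearMap.opNorm_le_bound _ zero_le_one fun μ => ?_
  rw [one_mul, pairing_apply, WeightedMeasureAlgebra.norm_def,
    integral_eq_lintegral_of_nonneg_ae
      (Eventually.of_forall WeightedMeasureAlgebra.weight_nonneg)
      ω.measurable'.aestronglyMeasurable]
  have hfin : ∫⁻ x, ENNReal.ofReal (ω x) ∂μ.toMeasure.variation ≠ ∞ := by
    have := μ.integrable_weight.2
    rw [hasFiniteIntegral_iff_ofReal
      (Eventually.of_forall WeightedMeasureAlgebra.weight_nonneg)] at this
    exact this.ne
  rw [← toReal_enorm]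
  refine ENNReal.toReal_mono hfin ((enorm_cintegral_le _ _).trans (lintegral_mono fun x => ?_))
  rw [← ofReal_norm]
  exact ENNReal.ofReal_le_ofReal (hh x)

theorem pairing_toAlgebra (h : G →ᵇ ℂ) (p : PosMeasure ω) :
    pairing ω h p.toAlgebra = ∫ x, h x ∂p.measure :=
  p.cintegral_toAlgebra h.continuous.measurable h.norm_coe_le_norm

/-- The left translate `y ↦ h (x y)`. -/
def translate (h : G →ᵇ ℂ) (x : G) : G →ᵇ ℂ :=
  h.compContinuous ⟨(x * ·), continuous_const_mul x⟩

@[simp] theorem translate_apply (h : G →ᵇ ℂ) (x y : G) : translate h x y = h (x * y) := rfl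

theorem norm_translate_le_norm (h : G →ᵇ ℂ) (x : G) : ‖translate h x‖ ≤ ‖h‖ :=
  BoundedContinuousFunction.norm_compContinuous_le _ _

theorem continuous_translate {h : G →ᵇ ℂ} (hh : HasCompactSupport h) :
    Continuous (translate h) := by
  rw [continuous_iff_continuousAt]
  intro x₀
  rw [ContinuousAt, Metric.tendsto_nhds]
  intro ε hε
  obtain ⟨V, hV, -, hVc⟩ := local_compact_nhds (univ_mem : univ ∈ 𝓝 x₀)
  -- all translates by elements of `V` are supported in the compact set `V⁻¹ * supp h`
  have hK : IsCompact ((fun q : G × G => q.1⁻¹ * q.2) '' (V ×ˢ tsupport h)) :=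
    (hVc.prod hh).image (by fun_prop)
  have h1 : ∀ᶠ x in 𝓝 x₀, ∀ y ∈ (fun q : G × G => q.1⁻¹ * q.2) '' (V ×ˢ tsupport h),
      dist (h (x * y)) (h (x₀ * y)) < ε / 2 := by
    refine hK.eventually_forall_of_forall_eventually fun y _ => ?_
    have hc : Continuous fun q : G × G => dist (h (q.1 * q.2)) (h (x₀ * q.2)) := by fun_prop
    refine (hc.continuousAt (x := (x₀, y))).eventually_lt_const ?_
    simpa using half_pos hε
  have h0 : ∀ x ∈ V, ∀ y, y ∉ (fun q : G × G => q.1⁻¹ * q.2) '' (V ×ˢ tsupport h) →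
      h (x * y) = 0 := fun x hx y hy => by
    by_contra hne
    exact hy ⟨(x, x * y), ⟨hx, subset_tsupport _ hne⟩, by simp⟩
  filter_upwards [h1, hV] with x hx hxV
  refine lt_of_le_of_lt ?_ (half_lt_self hε)
  refine (BoundedContinuousFunction.dist_le (half_pos hε).le).2 fun y => ?_
  by_cases hy : y ∈ (fun q : G × G => q.1⁻¹ * q.2) '' (V ×ˢ tsupport h)
  · exact (hx y hy).le
  · rw [translate_apply, translate_apply, h0 x hxV y hy, h0 x₀ (mem_of_mem_nhds hV) y hy,
      dist_self]
    exact (half_pos hε).le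

/-- The translates `translate h x` tend weakly to `0` as `x → ∞`: if the points `x` with
`ε ≤ ‖Ψ (translate h x)‖` lay in no compact set, a sequence of them would give translates with
disjoint supports, and unimodular combinations of these stay bounded by `‖h‖`, however many are
added. -/
theorem exists_isCompact_translate_lt {h : G →ᵇ ℂ} (hh : HasCompactSupport h)
    (Ψ : StrongDual ℂ (G →ᵇ ℂ)) {ε : ℝ} (hε : 0 < ε) :
    ∃ K : Set G, IsCompact K ∧ ∀ x ∉ K, ‖Ψ (translate h x)‖ < ε := by
  by_contra! hcon
  obtain ⟨x, hx, hdisj⟩ := exists_seq_of_forall_finset_exists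
    (fun x => ε ≤ ‖Ψ (translate h x)‖) (fun x y => ∀ z, h (x * z) = 0 ∨ h (y * z) = 0)
    (fun s _ => by
      have hK : IsCompact (⋃ x ∈ s,
          (fun q : G × G => q.1 * q.2⁻¹ * x) '' (tsupport h ×ˢ tsupport h)) :=
        s.isCompact_biUnion fun x _ => (hh.isCompact.prod hh).image (by fun_prop)
      obtain ⟨y, hy, hle⟩ := hcon _ hK
      refine ⟨y, hle, fun x hxs z => ?_⟩
      by_contra! hne
      refine hy (mem_iUnion₂.2 ⟨x, hxs, (y * z, x * z),
        ⟨subset_tsupport _ hne.2, subset_tsupport _ hne.1⟩, ?_⟩)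
      simp [mul_assoc])
  have hdisj' : ∀ m n, m ≠ n → ∀ z, h (x m * z) ≠ 0 → h (x n * z) = 0 := by
    intro m n hmn z hz
    rcases lt_or_gt_of_ne hmn with hlt | hlt
    · exact (hdisj m n hlt z).resolve_left hz
    · exact (hdisj n m hlt z).resolve_right hz
  have hphase : ∀ z : ℂ, ∃ c : ℂ, ‖c‖ ≤ 1 ∧ c * z = ‖z‖ := fun z => by
    refine ⟨(starRingEnd ℂ) z / ‖z‖, ?_, ?_⟩
    · rw [norm_div, RCLike.norm_conj, Complex.norm_real, norm_norm]
      exact div_self_le_one _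
    · rw [div_mul_eq_mul_div, mul_comm, Complex.mul_conj, Complex.normSq_eq_norm_sq]
      rcases eq_or_ne ‖z‖ 0 with h0 | h0
      · simp [h0]
      · push_cast
        field_simp
  choose c hc hcz using fun n => hphase (Ψ (translate h (x n)))
  have key : ∀ N : ℕ, N * ε ≤ ‖Ψ‖ * ‖h‖ := by
    intro N
    have hg : ‖∑ n ∈ Finset.range N, c n • translate h (x n)‖ ≤ ‖h‖ := by
      refine (BoundedContinuousFunction.norm_le (norm_nonneg h)).2 fun z => ?_
      simp only [BoundedContinuousFunction.coe_sum, Finset.sum_apply,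
        BoundedContinuousFunction.coe_smul, translate_apply, smul_eq_mul]
      by_cases hz : ∃ n ∈ Finset.range N, h (x n * z) ≠ 0
      · obtain ⟨n, hn, hne⟩ := hz
        rw [Finset.sum_eq_single_of_mem n hn fun m _ hm => by
          rw [hdisj' n m hm.symm z hne, mul_zero], norm_mul]
        exact (mul_le_of_le_one_left (norm_nonneg _) (hc n)).trans (h.norm_coe_le_norm _)
      · push Not at hz
        rw [Finset.sum_eq_zero fun n hn => by rw [hz n hn, mul_zero], norm_zero]
        exact norm_nonneg h
    have h1 : Ψ (∑ n ∈ Finset.range N, c n • translate h (x n)) =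
        ((∑ n ∈ Finset.range N, ‖Ψ (translate h (x n))‖ : ℝ) : ℂ) := by
      rw [map_sum, Complex.ofReal_sum]
      exact Finset.sum_congr rfl fun n _ => by rw [map_smul, smul_eq_mul, hcz]
    calc N * ε = ∑ n ∈ Finset.range N, ε := by simp
      _ ≤ ∑ n ∈ Finset.range N, ‖Ψ (translate h (x n))‖ := Finset.sum_le_sum fun n _ => hx n
      _ ≤ ‖((∑ n ∈ Finset.range N, ‖Ψ (translate h (x n))‖ : ℝ) : ℂ)‖ := by
        rw [Complex.norm_real]
        exact le_abs_self _
      _ = ‖Ψ (∑ n ∈ Finset.range N, c n • translate h (x n))‖ := by rw [h1]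
      _ ≤ ‖Ψ‖ * ‖h‖ := (Ψ.le_opNorm _).trans (mul_le_mul_of_nonneg_left hg (norm_nonneg Ψ))
  obtain ⟨N, hN⟩ := exists_nat_gt (‖Ψ‖ * ‖h‖ / ε)
  exact absurd (key N) (not_le.2 ((div_lt_iff₀ hε).1 hN))

theorem integrable_pairing_translate {h : G →ᵇ ℂ} (hh : HasCompactSupport h)
    (p : PosMeasure ω) : Integrable (fun x => pairing ω (translate h x)) p.measure := by
  refine Integrable.of_bound (aestronglyMeasurable_of_continuous _
    ((pairing ω).continuous.comp (continuous_translate hh))) (‖pairing ω‖ * ‖h‖)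
    (Eventually.of_forall fun x => ?_)
  exact ((pairing ω).le_opNorm _).trans
    (mul_le_mul_of_nonneg_left (norm_translate_le_norm h x) (norm_nonneg _))

/-- The action of a positive measure averages the translates of `h`. -/
theorem dualAct_pairing_toAlgebra {h : G →ᵇ ℂ} (hh : HasCompactSupport h) (p : PosMeasure ω) :
    dualAct (pairing ω h) p.toAlgebra = ∫ x, pairing ω (translate h x) ∂p.measure := by
  ext ν
  obtain ⟨h1, h2⟩ := cintegral_conv p.toAlgebra.toMeasure ν.toMeasure h.continuous.measurable
    h.norm_coe_le_norm
  rw [ContinuousLinearMap.integral_apply (integrable_pairing_translate hh p)]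
  change cintegral (conv p.toAlgebra.toMeasure ν.toMeasure) h = _
  rw [h2, p.cintegral_toAlgebra h1 fun x => norm_cintegral_le fun y => h.norm_coe_le_norm _]
  rfl

theorem apply_dualAct_pairing_toAlgebra {h : G →ᵇ ℂ} (hh : HasCompactSupport h)
    (p : PosMeasure ω) (Ψ : StrongDual ℂ (StrongDual ℂ (WeightedMeasureAlgebra ω))) :
    Ψ (dualAct (pairing ω h) p.toAlgebra) =
      ∫ x, Ψ (pairing ω (translate h x)) ∂p.measure := by
  rw [dualAct_pairing_toAlgebra hh, ContinuousLinearMap.integral_comp_comm Ψ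
    (integrable_pairing_translate hh p)]

/-! ### Compactness of the positive unit ball against functions vanishing at infinity -/

theorem exists_compactlySupported_eq_one {K : Set G} (hK : IsCompact K) :
    ∃ φ : C(G, ℝ), EqOn φ 1 K ∧ HasCompactSupport φ ∧ ∀ x, φ x ∈ Icc (0 : ℝ) 1 := by
  obtain ⟨φ, h1, -, h2, h3⟩ := exists_continuous_one_zero_of_isCompact hK isClosed_empty
    (disjoint_empty K)
  exact ⟨φ, h1, h2, h3⟩

/-- A regular measure whose weighted mass on compact sets is at most `1` lies in the
positive unit ball. -/
theorem exists_posMeasure_of_setLIntegral_le {m : Measure G} [m.Regular]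
    (h : ∀ K, IsCompact K → ∫⁻ x in K, ENNReal.ofReal (ω x) ∂m ≤ 1) :
    ∃ p : PosMeasure ω, p.measure = m ∧ ∫ x, ω x ∂m ≤ 1 := by
  have hfin : IsFiniteMeasure m := by
    refine ⟨lt_of_le_of_lt ?_ ENNReal.one_lt_top⟩
    rw [isOpen_univ.measure_eq_iSup_isCompact]
    refine iSup₂_le fun K _ => iSup_le fun hK => le_trans ?_ (h K hK)
    rw [← setLIntegral_one]
    refine lintegral_mono fun x => ?_
    rw [← ENNReal.ofReal_one]
    exact ENNReal.ofReal_le_ofReal (ω.one_le' x)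
  have hle : ∫⁻ x, ENNReal.ofReal (ω x) ∂m ≤ 1 := by
    obtain ⟨K, hmono, hK, h0⟩ := exists_isCompact_iUnion_ae m
    have h1 : m.restrict (⋃ n, K n) = m := by
      rw [Measure.restrict_eq_self_of_ae_mem]
      rw [ae_iff]
      exact h0
    rw [← h1, setLIntegral_iUnion_of_directed _ hmono.directed_le]
    exact iSup_le fun n => h _ (hK n)
  have hint : Integrable ω m := by
    refine ⟨ω.measurable'.aestronglyMeasurable, ?_⟩
    rw [hasFiniteIntegral_iff_ofReal (Eventually.of_forall WeightedMeasureAlgebra.weight_nonneg)]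
    exact hle.trans_lt ENNReal.one_lt_top
  refine ⟨⟨m, inferInstance, hint⟩, rfl, ?_⟩
  rw [integral_eq_lintegral_of_nonneg_ae
    (Eventually.of_forall WeightedMeasureAlgebra.weight_nonneg) ω.measurable'.aestronglyMeasurable]
  exact ENNReal.toReal_le_of_le_ofReal zero_le_one (by rwa [ENNReal.ofReal_one])

/-- The positive unit ball of `M_b(G, ω)` is compact for the vague topology: this is the
Riesz–Markov–Kakutani theorem applied to the limit functional along an ultrafilter. -/
theorem exists_vague_limit (hω : Continuous ω) {ι : Type*} (U : Ultrafilter ι)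
    (P : ι → PosMeasure ω) (hP : ∀ i, ∫ x, ω x ∂(P i).measure ≤ 1) :
    ∃ q : PosMeasure ω, ∫ x, ω x ∂q.measure ≤ 1 ∧ ∀ g : C_c(G, ℝ),
      Tendsto (fun i => ∫ x, g x ∂(P i).measure) U (𝓝 (∫ x, g x ∂q.measure)) := by
  have hlim : ∀ g : C_c(G, ℝ), ∃ L : ℝ, Tendsto (fun i => ∫ x, g x ∂(P i).measure) U (𝓝 L) := by
    intro g
    obtain ⟨C, hC⟩ := g.continuous.bounded_above_of_compact_support g.hasCompactSupport
    have hC0 : 0 ≤ C := (norm_nonneg _).trans (hC 1)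
    have hmem : ∀ i, ∫ x, g x ∂(P i).measure ∈ Icc (-C) C := fun i => by
      rw [mem_Icc, ← abs_le, ← Real.norm_eq_abs]
      refine (norm_integral_le_of_norm_le_const (Eventually.of_forall hC)).trans ?_
      exact mul_le_of_le_one_right hC0 (((P i).measureReal_univ_le).trans (hP i))
    obtain ⟨L, -, hL⟩ := isCompact_Icc.ultrafilter_le_nhds'
      (U.map fun i => ∫ x, g x ∂(P i).measure) (Ultrafilter.mem_map.2
        (Filter.Eventually.of_forall hmem))
    exact ⟨L, hL⟩
  choose L hL using hlim
  let Λ : C_c(G, ℝ) →ₚ[ℝ] ℝ := PositiveLinearMap.mk₀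
    { toFun := L
      map_add' := fun g k => by
        refine tendsto_nhds_unique (hL (g + k)) (((hL g).add (hL k)).congr fun i => ?_)
        exact (integral_add' g.integrable k.integrable).symm
      map_smul' := fun c g => by
        refine tendsto_nhds_unique (hL (c • g)) (((hL g).const_mul c).congr fun i => ?_)
        exact (integral_smul c g).symm }
    fun g hg => ge_of_tendsto' (hL g) fun i => integral_nonneg hg
  have hΛ : ∀ g : C_c(G, ℝ), ∫ x, g x ∂(RealRMK.rieszMeasure Λ) = L g := fun g =>
    RealRMK.integral_rieszMeasure Λ g
  obtain ⟨q, hq, hq1⟩ := exists_posMeasure_of_setLIntegral_le (ω := ω)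
      (m := RealRMK.rieszMeasure Λ) (fun K hK => by
    obtain ⟨φ, h1, h2, h3⟩ := exists_compactlySupported_eq_one hK
    let g : C_c(G, ℝ) := ⟨⟨fun x => φ x * ω x, by fun_prop⟩, h2.mul_right⟩
    have hg : ∀ x, g x = φ x * ω x := fun x => rfl
    have hg0 : ∀ x, 0 ≤ g x := fun x =>
      mul_nonneg (h3 x).1 (WeightedMeasureAlgebra.weight_nonneg x)
    have hLg : L g ≤ 1 := by
      refine le_of_tendsto' (hL g) fun i => le_trans ?_ (hP i)
      refine integral_mono g.integrable (P i).integrable fun x => ?_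
      exact mul_le_of_le_one_left (WeightedMeasureAlgebra.weight_nonneg x) (h3 x).2
    calc ∫⁻ x in K, ENNReal.ofReal (ω x) ∂(RealRMK.rieszMeasure Λ)
        = ∫⁻ x in K, ENNReal.ofReal (g x) ∂(RealRMK.rieszMeasure Λ) :=
          setLIntegral_congr_fun hK.measurableSet fun x hx => by
            simp [hg, h1 hx]
      _ ≤ ∫⁻ x, ENNReal.ofReal (g x) ∂(RealRMK.rieszMeasure Λ) := setLIntegral_le_lintegral _ _
      _ = ENNReal.ofReal (L g) := by
        rw [← hΛ, ofReal_integral_eq_lintegral_ofReal g.integrable (Eventually.of_forall hg0)]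
      _ ≤ 1 := by
        rw [← ENNReal.ofReal_one]
        exact ENNReal.ofReal_le_ofReal hLg)
  refine ⟨q, by rwa [hq], fun g => ?_⟩
  rw [hq, hΛ]
  exact hL g

/-- On measures of mass at most `1`, vague convergence implies convergence of the integrals of
continuous functions vanishing at infinity. -/
theorem tendsto_integral_of_vague {ι : Type*} {l : Filter ι} {P : ι → PosMeasure ω}
    (hP : ∀ i, ∫ x, ω x ∂(P i).measure ≤ 1) {q : PosMeasure ω} (hq : ∫ x, ω x ∂q.measure ≤ 1)
    (hlim : ∀ g : C_c(G, ℝ),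
      Tendsto (fun i => ∫ x, g x ∂(P i).measure) l (𝓝 (∫ x, g x ∂q.measure)))
    {h : G → ℂ} (hc : Continuous h) {C : ℝ} (hC : ∀ x, ‖h x‖ ≤ C)
    (h0 : ∀ ε > 0, ∃ K : Set G, IsCompact K ∧ ∀ x ∉ K, ‖h x‖ < ε) :
    Tendsto (fun i => ∫ x, h x ∂(P i).measure) l (𝓝 (∫ x, h x ∂q.measure)) := by
  rw [Metric.tendsto_nhds]
  intro ε hε
  obtain ⟨K, hK, hKε⟩ := h0 (ε / 3) (by positivity)
  obtain ⟨φ, h1, h2, h3⟩ := exists_compactlySupported_eq_one hK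
  have hint : ∀ p : PosMeasure ω, Integrable h p.measure := fun p =>
    Integrable.of_bound hc.measurable.aestronglyMeasurable C (Eventually.of_forall hC)
  let gr : C_c(G, ℝ) := ⟨⟨fun x => φ x * (h x).re, by fun_prop⟩, h2.mul_right⟩
  let gi : C_c(G, ℝ) := ⟨⟨fun x => φ x * (h x).im, by fun_prop⟩, h2.mul_right⟩
  have hφ : ∀ p : PosMeasure ω, Integrable (fun x => (φ x : ℂ) * h x) p.measure := fun p => by
    refine (hint p).bdd_mul (c := 1) (by fun_prop) (Eventually.of_forall fun x => ?_)
    rw [Complex.norm_real, Real.norm_of_nonneg (h3 x).1]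
    exact (h3 x).2
  have hsplit : ∀ p : PosMeasure ω, ∫ x, (φ x : ℂ) * h x ∂p.measure =
      ((∫ x, gr x ∂p.measure : ℝ) : ℂ) + ((∫ x, gi x ∂p.measure : ℝ) : ℂ) * Complex.I := by
    intro p
    rw [← integral_complex_ofReal, ← integral_complex_ofReal, ← integral_mul_const,
      ← integral_add gr.integrable.ofReal (gi.integrable.ofReal.mul_const _)]
    refine integral_congr_ae (Eventually.of_forall fun x => ?_)
    change (φ x : ℂ) * h x = ((φ x * (h x).re : ℝ) : ℂ) + ((φ x * (h x).im : ℝ) : ℂ) * Complex.I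
    conv_lhs => rw [← Complex.re_add_im (h x)]
    push_cast
    ring
  have hnear : ∀ p : PosMeasure ω, ∫ x, ω x ∂p.measure ≤ 1 →
      dist (∫ x, h x ∂p.measure) (∫ x, (φ x : ℂ) * h x ∂p.measure) ≤ ε / 3 := by
    intro p hp
    rw [dist_eq_norm, ← integral_sub (hint p) (hφ p)]
    refine (norm_integral_le_of_norm_le_const (C := ε / 3)
      (Eventually.of_forall fun x => ?_)).trans
      (mul_le_of_le_one_right (by positivity) (p.measureReal_univ_le.trans hp))
    by_cases hx : x ∈ K
    · simp only [h1 hx, Pi.one_apply, Complex.ofReal_one, one_mul, sub_self, norm_zero]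
      positivity
    · have : h x - φ x * h x = ((1 - φ x : ℝ) : ℂ) * h x := by
        push_cast
        ring
      rw [this, norm_mul, Complex.norm_real,
        Real.norm_of_nonneg (sub_nonneg.2 (h3 x).2)]
      exact (mul_le_of_le_one_left (norm_nonneg _) (by linarith [(h3 x).1])).trans (hKε x hx).le
  have hφlim : Tendsto (fun i => ∫ x, (φ x : ℂ) * h x ∂(P i).measure) l
      (𝓝 (∫ x, (φ x : ℂ) * h x ∂q.measure)) := by
    simp_rw [hsplit]
    exact ((Complex.continuous_ofReal.tendsto _).comp (hlim gr)).add
      (((Complex.continuous_ofReal.tendsto _).comp (hlim gi)).mul_const _)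
  filter_upwards [Metric.tendsto_nhds.1 hφlim (ε / 3) (by positivity)] with i hi
  have e1 := hnear (P i) (hP i)
  have e2 := hnear q hq
  rw [dist_comm] at e2
  have := dist_triangle4 (∫ x, h x ∂(P i).measure) (∫ x, (φ x : ℂ) * h x ∂(P i).measure)
    (∫ x, (φ x : ℂ) * h x ∂q.measure) (∫ x, h x ∂q.measure)
  linarith

/-! ### Compactly supported functions are weakly almost periodic -/

theorem tendsto_toWeakSpace {E ι : Type*} [NormedAddCommGroup E] [NormedSpace ℂ E]
    {l : Filter ι} {u : ι → E} {v : E} (h : ∀ Ψ : StrongDual ℂ E,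
      Tendsto (fun i => Ψ (u i)) l (𝓝 (Ψ v))) :
    Tendsto (fun i => toWeakSpace ℂ E (u i)) l (𝓝 (toWeakSpace ℂ E v)) := by
  have hind : IsInducing fun (x : WeakSpace ℂ E) (Ψ : StrongDual ℂ E) =>
      Ψ ((toWeakSpace ℂ E).symm x) := ⟨rfl⟩
  rw [hind.tendsto_nhds_iff, tendsto_pi_nhds]
  exact h

/-- The orbit of a compactly supported function under the positive unit ball is weakly compact:
the limit along an ultrafilter is the action of the vague limit of the measures. -/
theorem isCompact_dualAct_posMeasure (hω : Continuous ω) {h : G →ᵇ ℂ}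
    (hh : HasCompactSupport h) :
    IsCompact ((fun p : PosMeasure ω => toWeakSpace ℂ (StrongDual ℂ (WeightedMeasureAlgebra ω))
      (dualAct (pairing ω h) p.toAlgebra)) '' {p | ∫ x, ω x ∂p.measure ≤ 1}) := by
  rw [image_eq_range, isCompact_iff_ultrafilter_le_nhds']
  intro U hU
  let T : {p : PosMeasure ω // ∫ x, ω x ∂p.measure ≤ 1} →
      WeakSpace ℂ (StrongDual ℂ (WeightedMeasureAlgebra ω)) := fun p =>
    toWeakSpace ℂ (StrongDual ℂ (WeightedMeasureAlgebra ω)) (dualAct (pairing ω h) p.1.toAlgebra)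
  let V := Ultrafilter.ofComapInfPrincipal (m := T) (s := univ) (g := U)
    (by rw [image_univ]; exact hU)
  have hV : V.map T = U := Ultrafilter.ofComapInfPrincipal_eq_of_map _
  obtain ⟨q, hq, hlim⟩ := exists_vague_limit hω V (fun p => p.1) (fun p => p.2)
  refine ⟨T ⟨q, hq⟩, mem_range_self (f := T) ⟨q, hq⟩, ?_⟩
  rw [← hV]
  refine tendsto_toWeakSpace fun Ψ => ?_
  simp_rw [apply_dualAct_pairing_toAlgebra hh]
  refine tendsto_integral_of_vague (fun p => p.2) hq hlim
    (Ψ.continuous.comp ((pairing ω).continuous.comp (continuous_translate hh)))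
    (C := ‖Ψ.comp (pairing ω)‖ * ‖h‖) (fun x => ?_)
    (fun ε hε => exists_isCompact_translate_lt hh (Ψ.comp (pairing ω)) hε)
  exact ((Ψ.comp (pairing ω)).le_opNorm _).trans
    (mul_le_mul_of_nonneg_left (norm_translate_le_norm h x) (norm_nonneg _))

theorem isWeaklyAlmostPeriodic_pairing (hω : Continuous ω) {h : G →ᵇ ℂ}
    (hh : HasCompactSupport h) : IsWeaklyAlmostPeriodic (pairing ω h) := by
  have hS := isCompact_dualAct_posMeasure hω hh
  have hK := (hS.add hS.neg).add ((hS.add hS.neg).image (continuous_const_smul Complex.I))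
  refine IsCompact.closure_of_subset hK ?_
  rintro _ ⟨μ, hμ, rfl⟩
  obtain ⟨p, q, r, s, -, -, hp, hq, hr, hs, hdec⟩ := exists_posMeasure_decomposition μ
  have hmem : ∀ t : PosMeasure ω, t.measure ≤ μ.toMeasure.variation →
      t ∈ {p : PosMeasure ω | ∫ x, ω x ∂p.measure ≤ 1} := fun t ht =>
    (PosMeasure.integral_le_norm ht).trans hμ
  refine ⟨_, add_mem_add (mem_image_of_mem _ (hmem p hp))
      (neg_mem_neg.2 (mem_image_of_mem _ (hmem q hq))), _,
    mem_image_of_mem _ (add_mem_add (mem_image_of_mem _ (hmem r hr))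
      (neg_mem_neg.2 (mem_image_of_mem _ (hmem s hs)))), ?_⟩
  simp only [← map_neg, ← map_smul, ← map_add]
  congr 1
  conv_rhs => rw [hdec]
  simp only [← sub_eq_add_neg, dualAct, map_add, map_sub, map_smul, ContinuousLinearMap.comp_add,
    ContinuousLinearMap.comp_sub, ContinuousLinearMap.comp_smul]

/-! ### Compactly supported functions norm the algebra -/

theorem PosMeasure.exists_setIntegral_le (p : PosMeasure ω) {ε : ℝ} (hε : 0 < ε) :
    ∃ δ : ℝ≥0∞, δ ≠ 0 ∧ ∀ s, p.measure s < δ → ∫ x in s, ω x ∂p.measure ≤ ε := by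
  have hfin : ∫⁻ x, ENNReal.ofReal (ω x) ∂p.measure ≠ ∞ := by
    have := p.integrable.2
    rw [hasFiniteIntegral_iff_ofReal
      (Eventually.of_forall WeightedMeasureAlgebra.weight_nonneg)] at this
    exact this.ne
  obtain ⟨δ, hδ, h⟩ := exists_pos_setLIntegral_lt_of_measure_lt hfin
    (ENNReal.ofReal_pos.2 hε).ne'
  refine ⟨δ, hδ.ne', fun s hs => ?_⟩
  rw [integral_eq_lintegral_of_nonneg_ae
    (Eventually.of_forall WeightedMeasureAlgebra.weight_nonneg) ω.measurable'.aestronglyMeasurable]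
  exact ENNReal.toReal_le_of_le_ofReal hε.le (h s hs).le

/-- Mutually singular positive measures are separated by a compactly supported continuous
function `0 ≤ g ≤ ω`: take `g = φ ω` with `φ` a bump function at a large compact subset of a set
carrying the first measure. -/
theorem exists_separating {p q : PosMeasure ω} (hω : Continuous ω)
    (hpq : p.measure ⟂ₘ q.measure) {ε : ℝ} (hε : 0 < ε) :
    ∃ g : C(G, ℝ), HasCompactSupport g ∧ (∀ x, 0 ≤ g x) ∧ (∀ x, g x ≤ ω x) ∧
      ∫ x, ω x ∂p.measure - ε ≤ ∫ x, g x ∂p.measure - ∫ x, g x ∂q.measure := by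
  obtain ⟨H, hH, hpH, hqH⟩ := hpq
  obtain ⟨δ, hδ, hpδ⟩ := p.exists_setIntegral_le (half_pos hε)
  obtain ⟨η, hη, hqη⟩ := q.exists_setIntegral_le (half_pos hε)
  obtain ⟨K, hKH, hK, hKlt⟩ := hH.compl.exists_isCompact_sdiff_lt
    (measure_ne_top p.measure _) hδ
  have hpK : p.measure Kᶜ < δ := by
    refine lt_of_le_of_lt ?_ hKlt
    calc p.measure Kᶜ ≤ p.measure (H ∪ Hᶜ \ K) := measure_mono fun x hx => by
          by_cases h : x ∈ H
          · exact Or.inl h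
          · exact Or.inr ⟨h, hx⟩
      _ ≤ p.measure H + p.measure (Hᶜ \ K) := measure_union_le _ _
      _ = p.measure (Hᶜ \ K) := by rw [hpH, zero_add]
  have hqK : q.measure K < η := by
    rw [measure_mono_null hKH hqH]
    exact hη.bot_lt
  obtain ⟨V, hKV, hV, hqV⟩ := K.exists_isOpen_lt_of_lt η hqK
  obtain ⟨φ, h1, h0, hφ, h01⟩ := exists_continuous_one_zero_of_isCompact hK hV.isClosed_compl
    (disjoint_compl_right_iff_subset.2 hKV)
  have hnn : ∀ x, 0 ≤ φ x * ω x := fun x =>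
    mul_nonneg (h01 x).1 (WeightedMeasureAlgebra.weight_nonneg x)
  have hle : ∀ x, φ x * ω x ≤ ω x := fun x =>
    mul_le_of_le_one_left (WeightedMeasureAlgebra.weight_nonneg x) (h01 x).2
  have hint : ∀ r : PosMeasure ω, Integrable (fun x => φ x * ω x) r.measure := fun r =>
    r.integrable.mono' (by fun_prop) (Eventually.of_forall fun x => by
      rw [Real.norm_of_nonneg (hnn x)]
      exact hle x)
  refine ⟨⟨fun x => φ x * ω x, by fun_prop⟩, hφ.mul_right, hnn, hle, ?_⟩
  have e1 : ∫ x, ω x ∂p.measure - ε / 2 ≤ ∫ x, φ x * ω x ∂p.measure := by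
    rw [← integral_add_compl hK.measurableSet p.integrable]
    have e2 : ∫ x in K, ω x ∂p.measure ≤ ∫ x, φ x * ω x ∂p.measure := by
      rw [setIntegral_congr_fun (g := fun x => φ x * ω x) hK.measurableSet fun x hx => by
        simp [h1 hx]]
      exact setIntegral_le_integral (hint p) (Eventually.of_forall hnn)
    linarith [hpδ _ hpK]
  have e3 : ∫ x, φ x * ω x ∂q.measure ≤ ε / 2 := by
    rw [← setIntegral_eq_integral_of_forall_compl_eq_zero (s := V) fun x hx => by
      simp [h0 (show x ∈ Vᶜ from hx)]]
    exact (setIntegral_mono (hint q).integrableOn q.integrable.integrableOn hle).trans (hqη V hqV)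
  change _ ≤ ∫ x, φ x * ω x ∂p.measure - ∫ x, φ x * ω x ∂q.measure
  linarith

/-- Every element of norm at least `1` is detected by a compactly supported function dominated
by the weight. One of the four parts of the Jordan decomposition has weighted mass at least `1/4`,
and half of it survives the separation from the part of opposite sign. -/
theorem exists_pairing_ge (hω : Continuous ω) {μ : WeightedMeasureAlgebra ω} (hμ : 1 ≤ ‖μ‖) :
    ∃ h : G →ᵇ ℂ, HasCompactSupport h ∧ (∀ x, ‖h x‖ ≤ ω x) ∧ 1 / 8 ≤ ‖pairing ω h μ‖ := by
  obtain ⟨p, q, r, s, hpq, hrs, -, -, -, -, hdec⟩ := exists_posMeasure_decomposition μ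
  have hsum : 1 ≤ (∫ x, ω x ∂p.measure + ∫ x, ω x ∂q.measure) +
      (∫ x, ω x ∂r.measure + ∫ x, ω x ∂s.measure) := by
    calc 1 ≤ ‖μ‖ := hμ
      _ = ‖(p.toAlgebra - q.toAlgebra) + Complex.I • (r.toAlgebra - s.toAlgebra)‖ := by
        rw [← hdec]
      _ ≤ ‖p.toAlgebra - q.toAlgebra‖ + ‖Complex.I • (r.toAlgebra - s.toAlgebra)‖ :=
        norm_add_le _ _
      _ = ‖p.toAlgebra - q.toAlgebra‖ + ‖r.toAlgebra - s.toAlgebra‖ := by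
        rw [norm_smul, Complex.norm_I, one_mul]
      _ ≤ (‖p.toAlgebra‖ + ‖q.toAlgebra‖) + (‖r.toAlgebra‖ + ‖s.toAlgebra‖) :=
        add_le_add (norm_sub_le _ _) (norm_sub_le _ _)
      _ ≤ _ := by gcongr <;> exact PosMeasure.norm_toAlgebra_le _
  -- for real `g`, the real and imaginary parts of the pairing see the two Jordan pairs separately
  have hpair : ∀ g : C(G, ℝ), HasCompactSupport g → (∀ x, 0 ≤ g x) → (∀ x, g x ≤ ω x) →
      ∃ h : G →ᵇ ℂ, HasCompactSupport h ∧ (∀ x, ‖h x‖ ≤ ω x) ∧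
        |∫ x, g x ∂p.measure - ∫ x, g x ∂q.measure| ≤ ‖pairing ω h μ‖ ∧
        |∫ x, g x ∂r.measure - ∫ x, g x ∂s.measure| ≤ ‖pairing ω h μ‖ := by
    intro g hg hg0 hgω
    obtain ⟨C, hC⟩ := g.continuous.bounded_above_of_compact_support hg
    let h : G →ᵇ ℂ := BoundedContinuousFunction.ofNormedAddCommGroup (fun x => (g x : ℂ))
      (by fun_prop) C fun x => by simpa using hC x
    have hval : ∀ t : PosMeasure ω, pairing ω h t.toAlgebra = ((∫ x, g x ∂t.measure : ℝ) : ℂ) :=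
      fun t => by
        rw [pairing_toAlgebra, ← integral_complex_ofReal]
        rfl
    have hμh : pairing ω h μ = ((∫ x, g x ∂p.measure - ∫ x, g x ∂q.measure : ℝ) : ℂ) +
        ((∫ x, g x ∂r.measure - ∫ x, g x ∂s.measure : ℝ) : ℂ) * Complex.I := by
      rw [hdec, map_add, map_smul, map_sub, map_sub, hval, hval, hval, hval]
      push_cast
      rw [smul_eq_mul, mul_comm Complex.I]
    refine ⟨h, ?_, fun x => ?_, ?_, ?_⟩
    · exact hg.comp_left (g := fun t : ℝ => (t : ℂ)) Complex.ofReal_zero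
    · change ‖(g x : ℂ)‖ ≤ ω x
      rw [Complex.norm_real, Real.norm_of_nonneg (hg0 x)]
      exact hgω x
    · refine le_trans (le_of_eq ?_) (Complex.abs_re_le_norm _)
      rw [hμh]
      simp
    · refine le_trans (le_of_eq ?_) (Complex.abs_im_le_norm _)
      rw [hμh]
      simp
  have hbig : 1 / 4 ≤ ∫ x, ω x ∂p.measure ∨ 1 / 4 ≤ ∫ x, ω x ∂q.measure ∨
      1 / 4 ≤ ∫ x, ω x ∂r.measure ∨ 1 / 4 ≤ ∫ x, ω x ∂s.measure := by
    by_contra! hcon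
    obtain ⟨h1, h2, h3, h4⟩ := hcon
    linarith
  have h8 : (0 : ℝ) < 1 / 8 := by norm_num
  rcases hbig with hb | hb | hb | hb
  · obtain ⟨g, hg, hg0, hgω, hsep⟩ := exists_separating hω hpq h8
    obtain ⟨h, hh, hhω, hre, -⟩ := hpair g hg hg0 hgω
    exact ⟨h, hh, hhω, by linarith [le_abs_self (∫ x, g x ∂p.measure - ∫ x, g x ∂q.measure)]⟩
  · obtain ⟨g, hg, hg0, hgω, hsep⟩ := exists_separating hω hpq.symm h8
    obtain ⟨h, hh, hhω, hre, -⟩ := hpair g hg hg0 hgω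
    exact ⟨h, hh, hhω, by linarith [neg_abs_le (∫ x, g x ∂p.measure - ∫ x, g x ∂q.measure)]⟩
  · obtain ⟨g, hg, hg0, hgω, hsep⟩ := exists_separating hω hrs h8
    obtain ⟨h, hh, hhω, -, him⟩ := hpair g hg hg0 hgω
    exact ⟨h, hh, hhω, by linarith [le_abs_self (∫ x, g x ∂r.measure - ∫ x, g x ∂s.measure)]⟩
  · obtain ⟨g, hg, hg0, hgω, hsep⟩ := exists_separating hω hrs.symm h8
    obtain ⟨h, hh, hhω, -, him⟩ := hpair g hg hg0 hgω
    exact ⟨h, hh, hhω, by linarith [neg_abs_le (∫ x, g x ∂r.measure - ∫ x, g x ∂s.measure)]⟩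

end WeightedConvolution
end

theorem mainTheorem1 {G : Type*} [Group G] [TopologicalSpace G] [IsTopologicalGroup G]
    [LocallyCompactSpace G] [T2Space G] [MeasurableSpace G] [BorelSpace G]
    (ω : WeightedConvolution.Weight G) (hω : Continuous ω) :
    WeightedConvolution.IsWAPAlgebra (WeightedConvolution.WeightedMeasureAlgebra ω) := by
  refine ⟨1 / 8, by norm_num, fun μ hμ => ?_⟩
  obtain ⟨h, hh, hhω, hle⟩ := WeightedConvolution.exists_pairing_ge hω hμ
  let f : WeightedConvolution.WAP (WeightedConvolution.WeightedMeasureAlgebra ω) :=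
    ⟨WeightedConvolution.pairing ω h, WeightedConvolution.isWeaklyAlmostPeriodic_pairing hω hh⟩
  have hf : ‖f‖ ≤ 1 := WeightedConvolution.norm_pairing_le_one hhω
  have h1 : ‖WeightedConvolution.pairing ω h μ‖ ≤
      ‖WeightedConvolution.toWapDual (WeightedConvolution.WeightedMeasureAlgebra ω) μ‖ * ‖f‖ :=
    (WeightedConvolution.toWapDual _ μ).le_opNorm f
  exact hle.trans (h1.trans (mul_le_of_le_one_right (norm_nonneg _) hf))
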